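/- Let $H\in(1/2,1)$, $\sigma>0$, $s_0>0$, and let $\xi_1,\xi_2,\dots$ be i.i.d. random variables on a probability space $(\Omega,\mathcal F,P)$ with $P(\xi_i=1)=P(\xi_i=-1)=1/2$. Put $\mathcal F_n=\sigma(\xi_1,\dots,\xi_n)$, with $\mathcal F_0$ trivial. Let $C_H=(H-\tfrac12)\sqrt{\frac{2H\,\Gamma(3/2-H)}{\Gamma(H+1/2)\,\Gamma(2-2H)}}$ and, for $1\le i<n$, $$j_n(i)=\sigma C_H\int_{i-1}^{i}x^{\frac12-H}\Big(\int_0^1(v+n-1)^{H-\frac12}(v+n-1-x)^{H-\frac32}dv\Big)dx,$$ $$g_n=\sigma C_H\int_{n-1}^{n}x^{\frac12-H}(n-x)^{H-\frac12}\Big(\int_0^1(y(n-x)+x)^{H-\frac12}y^{H-\frac32}dy\Big)dx .$$ Set $\mathcal Y_n=\sum_{i=1}^{n-1}j_n(i)\xi_i$ and $X_n=\mathcal Y_n+g_n\xi_n$ for $n\ge1$, and $g_0=\mathcal Y_0=X_0=0$. For $N\ge1$, the (driftless) $N$-fractional binary market has bond $B^N_n=1$ and stock $S^N_0=s_0$,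 $S^N_n=(1+X_nN^{-H})S^N_{n-1}$, $n=1,\dots,N$. A frictionless self-financing strategy with zero endowment is an adapted process $\phi=(\phi^0_n,\phi^1_n)_{n=-1}^N$ of bond and stock positions with $\phi^0_{-1}=\phi^1_{-1}=0$ and $\phi^0_n-\phi^0_{n-1}\le-(\phi^1_n-\phi^1_{n-1})S^N_n$ for $0\le n\le N$; its value is $V_n(\phi)=\phi^0_n+\phi^1_nS^N_n$. For $k\ge1$ let $\theta^{(1)}_k=g_{k-1}g_k\xi_{k-1}\xi_k$, $\theta^{(2)}_k=g_k\xi_k\mathcal Y_{k-1}$, $\theta^{(3)}_k=g_{k-1}\xi_{k-1}\mathcal Y_k$, $\theta^{(4)}_k=\mathcal Y_{k-1}\mathcal Y_k$ (so that $\theta_1^{(i)}=0$ for all $i$), and $\mathcal S^{(i)}_n=\sum_{k=1}^n\theta^{(i)}_k$. With $\varepsilon_N=\ln(N)\,N^{-\min(1/2,\,2-2H)}$ let $$T^{(N,i)}=\inf\{k\in\{1,\dots,N\}:\tfrac1N\mathcal S^{(i)}_k<-\varepsilon_N\}\quad(\inf\emptyset=\infty),$$ $$T_N=T^{(N,1)}\wedge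 T^{(N,2)}\wedge(T^{(N,3)}-1)\wedge(T^{(N,4)}-1).$$ Then there are constants $C_1^\theta,C_2^\theta>0$ such that, almost surely, $\sup_{1\le n\le N}|\theta^{(i)}_n|\le C_i^\theta N^{H-1/2}$ for all $N\ge1$ and $i=1,2$. For any such constants, put $$\hat c_N=4\varepsilon_N+\frac{C_1^\theta+C_2^\theta}{N^{3/2-H}},$$ and let $\psi^N$ be the strategy with zero endowment whose stock position is $$\psi^{1,N}_{-1}=\psi^{1,N}_0=0,\qquad \psi^{1,N}_k=\frac1{\sqrt{\hat c_N}}\,1_{\{k<T_N\}}\,N^{H-1}\frac{X_k}{S^N_k}\quad(1\le k\le N)$$ (read as $0$ where $S^N_k=0$, which can happen for finitely many $N$ only), and whose bond position is determined by $\psi^{0,N}_{-1}=0$ and the self-financing condition with equality. Then $(\psi^N)_{N\ge1}$ provides a strong asymptotic arbitrage: each $\psi^N$ is a self-financing strategy with zero endowment, and there are positive reals $c_N\to0$ and $C_N\to\infty$ such that, for every $N\ge1$ and every $n\in\{0,\dots,N\}$, $V_n(\psi^N)\ge-c_N$ almost surely, and $$\lim_{N\to\infty}P\big(V_N(\psi^N)\ge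 C_N\big)=1 .$$ -/

import Mathlib

open MeasureTheory ProbabilityTheory Filter Topology

namespace FractionalBinary

noncomputable section

/-! ### The driving noise -/

/-- `ξ 1, ξ 2, …` are independent fair signs under `P` (the value `ξ 0` plays no role). -/
structure IsFairSignSequence {Ω : Type*} [MeasurableSpace Ω] (P : Measure Ω)
    (ξ : ℕ → Ω → ℝ) : Prop where
  measurable : ∀ i, 1 ≤ i → Measurable (ξ i)
  indep : iIndepFun (fun i : ℕ => ξ (i + 1)) P
  prob_one : ∀ i, 1 ≤ i → P {ω | ξ i ω = 1} = 1 / 2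
  prob_neg_one : ∀ i, 1 ≤ i → P {ω | ξ i ω = -1} = 1 / 2

/-- The σ-algebra `F_n = σ(ξ 1, …, ξ n)`; `F_0` is trivial. -/
def info {Ω : Type*} (ξ : ℕ → Ω → ℝ) (n : ℕ) : MeasurableSpace Ω :=
  ⨆ i ∈ Finset.Icc 1 n, MeasurableSpace.comap (ξ i) inferInstance

/-! ### The fractional binary markets (without drift) -/

/-- The normalizing constant of the Molchan–Golosov kernel of fractional Brownian motion. -/
def kernelConst (H : ℝ) : ℝ :=
  (H - 1 / 2) *
    √(2 * H * Real.Gamma (3 / 2 - H) / (Real.Gamma (H + 1 / 2) * Real.Gamma (2 - 2 * H)))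

/-- The coefficient `j_n(i)`, used for `1 ≤ i ≤ n - 1`. -/
def jCoef (H σ : ℝ) (n i : ℕ) : ℝ :=
  σ * kernelConst H *
    ∫ x in ((i : ℝ) - 1)..(i : ℝ), x ^ (1 / 2 - H) *
      ∫ v in (0 : ℝ)..1, (v + n - 1) ^ (H - 1 / 2) * (v + n - 1 - x) ^ (H - 3 / 2)

/-- The coefficient `g_n` for `n ≥ 1`. By convention `g_0 = 0`, which amounts to `X_0 = 0`. -/
def gCoef (H σ : ℝ) (n : ℕ) : ℝ :=
  if n = 0 then 0 else
    σ * kernelConst H *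
      ∫ x in ((n : ℝ) - 1)..(n : ℝ), x ^ (1 / 2 - H) * (n - x) ^ (H - 1 / 2) *
        ∫ y in (0 : ℝ)..1, (y * (n - x) + x) ^ (H - 1 / 2) * y ^ (H - 3 / 2)

variable {Ω : Type*}

/-- `Y_n = ∑_{i=1}^{n-1} j_n(i) ξ_i`. -/
def yProc (H σ : ℝ) (ξ : ℕ → Ω → ℝ) (n : ℕ) (ω : Ω) : ℝ :=
  ∑ i ∈ Finset.Ico 1 n, jCoef H σ n i * ξ i ω

/-- `X_n = Y_n + g_n ξ_n` (and `X_0 = 0`). -/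
def xProc (H σ : ℝ) (ξ : ℕ → Ω → ℝ) (n : ℕ) (ω : Ω) : ℝ :=
  yProc H σ ξ n ω + gCoef H σ n * ξ n ω

/-- The stock price `S_n^N` of the `N`-fractional binary market; the bond is constantly `1`. -/
def stockPrice (H σ s₀ : ℝ) (ξ : ℕ → Ω → ℝ) (N : ℕ) : ℕ → Ω → ℝ
  | 0, _ => s₀
  | n + 1, ω => (1 + xProc H σ ξ (n + 1) ω / (N : ℝ) ^ H) * stockPrice H σ s₀ ξ N n ω

/-! ### Trading strategies -/

/-- A trading strategy `(φ_n^0, φ_n^1)`, `n = -1, 0, 1, …`, in bond and stock. The positions at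
time `-1`, before any information is available, are constants; a market with horizon `N` uses
the positions at times `-1, 0, …, N` only. -/
structure Strategy (Ω : Type*) where
  bondInit : ℝ
  stockInit : ℝ
  bond : ℕ → Ω → ℝ
  stock : ℕ → Ω → ℝ

/-- `Δ_n f = f_n - f_{n-1}` for a process `f` with value `init` at time `-1`. -/
def increment (init : ℝ) (f : ℕ → Ω → ℝ) : ℕ → Ω → ℝ
  | 0, ω => f 0 ω - init
  | n + 1, ω => f (n + 1) ω - f n ω

/-- `φ` is a `lam`-self-financing strategy for the price process `S` up to time `N`: it is adapted
to `σ(ξ_1, …, ξ_n)` and satisfies the self-financing inequality. -/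
structure IsSelfFinancing (ξ : ℕ → Ω → ℝ) (S : ℕ → Ω → ℝ) (lam : ℝ) (N : ℕ)
    (φ : Strategy Ω) : Prop where
  adapted_bond : ∀ n ≤ N, Measurable[info ξ n] (φ.bond n)
  adapted_stock : ∀ n ≤ N, Measurable[info ξ n] (φ.stock n)
  financing : ∀ n ≤ N, ∀ ω,
    increment φ.bondInit φ.bond n ω ≤
      -((increment φ.stockInit φ.stock n ω)⁺ * S n ω)
        + (1 - lam) * (increment φ.stockInit φ.stock n ω)⁻ * S n ω

/-- The liquidation value `V_n^lam(φ)`. -/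
def liquidationValue (S : ℕ → Ω → ℝ) (lam : ℝ) (φ : Strategy Ω) (n : ℕ) (ω : Ω) : ℝ :=
  φ.bond n ω + (1 - lam) * (φ.stock n ω)⁺ * S n ω - (φ.stock n ω)⁻ * S n ω

/-- The strategy with zero endowment (no bond and no stock at time `-1`) and stock position `φ1`,
whose bond position is given by the self-financing condition with equality. -/
def ofStock (S : ℕ → Ω → ℝ) (lam : ℝ) (φ1 : ℕ → Ω → ℝ) : Strategy Ω where
  bondInit := 0
  stockInit := 0
  bond n ω :=
    0 - ∑ k ∈ Finset.range (n + 1), (increment 0 φ1 k ω)⁺ * S k ω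
      + (1 - lam) * ∑ k ∈ Finset.range (n + 1), (increment 0 φ1 k ω)⁻ * S k ω
  stock := φ1

/-- The sequence of strategies `(φ N)_{N ≥ 1}` provides a strong asymptotic arbitrage in the
sequence of markets with price processes `S N`, horizon `N` and transaction costs `lam N`. -/
def ProvidesStrongAsymptoticArbitrage [MeasurableSpace Ω] (P : Measure Ω) (ξ : ℕ → Ω → ℝ)
    (S : ℕ → ℕ → Ω → ℝ) (lam : ℕ → ℝ) (φ : ℕ → Strategy Ω) : Prop :=
  (∀ N, 1 ≤ N → IsSelfFinancing ξ (S N) (lam N) N (φ N) ∧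
    (φ N).bondInit = 0 ∧ (φ N).stockInit = 0) ∧
  ∃ c C : ℕ → ℝ,
    (∀ N, 1 ≤ N → 0 < c N ∧ 0 < C N) ∧
    Tendsto c atTop (𝓝 0) ∧
    Tendsto C atTop atTop ∧
    (∀ N, 1 ≤ N → ∀ n ≤ N, ∀ᵐ ω ∂P, -c N ≤ liquidationValue (S N) (lam N) (φ N) n ω) ∧
    Tendsto (fun N => P {ω | C N ≤ liquidationValue (S N) (lam N) (φ N) N ω}) atTop (𝓝 1)

/-! ### The strategies -/

/-- `φ_0^{1,N} = 0` and `φ_k^{1,N} = N^{H-1} X_k / S_k^N` for `k ≥ 1`. -/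
def phiStock (H σ s₀ : ℝ) (ξ : ℕ → Ω → ℝ) (N k : ℕ) (ω : Ω) : ℝ :=
  if k = 0 then 0 else
    (N : ℝ) ^ (H - 1) * (xProc H σ ξ k ω / stockPrice H σ s₀ ξ N k ω)

/-- `θ_k^{(1)} = g_{k-1} g_k ξ_{k-1} ξ_k`, `k ≥ 1`. -/
def theta1 (H σ : ℝ) (ξ : ℕ → Ω → ℝ) (k : ℕ) (ω : Ω) : ℝ :=
  gCoef H σ (k - 1) * gCoef H σ k * ξ (k - 1) ω * ξ k ω

/-- `θ_k^{(2)} = g_k ξ_k Y_{k-1}`, `k ≥ 1`. -/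
def theta2 (H σ : ℝ) (ξ : ℕ → Ω → ℝ) (k : ℕ) (ω : Ω) : ℝ :=
  gCoef H σ k * ξ k ω * yProc H σ ξ (k - 1) ω

/-- `θ_k^{(3)} = g_{k-1} ξ_{k-1} Y_k`, `k ≥ 1`. -/
def theta3 (H σ : ℝ) (ξ : ℕ → Ω → ℝ) (k : ℕ) (ω : Ω) : ℝ :=
  gCoef H σ (k - 1) * ξ (k - 1) ω * yProc H σ ξ k ω

/-- `θ_k^{(4)} = Y_{k-1} Y_k`, `k ≥ 1`. -/
def theta4 (H σ : ℝ) (ξ : ℕ → Ω → ℝ) (k : ℕ) (ω : Ω) : ℝ :=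
  yProc H σ ξ (k - 1) ω * yProc H σ ξ k ω

/-- The partial sums `∑_{k=1}^n θ_k`. -/
def partialSum (θ : ℕ → Ω → ℝ) (n : ℕ) (ω : Ω) : ℝ :=
  ∑ k ∈ Finset.Icc 1 n, θ k ω

/-- The first `k ∈ {1, …, N}` with `(1/N) ∑_{l=1}^k θ_l < -ε`, and `∞` if there is none. -/
def dropTime (θ : ℕ → Ω → ℝ) (N : ℕ) (ε : ℝ) (ω : Ω) : ℕ∞ :=
  ⨅ (k : ℕ) (_ : k ∈ Finset.Icc 1 N ∧ 1 / (N : ℝ) * partialSum θ k ω < -ε), (k : ℕ∞)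

/-- `ε_N = ln N / N^{min(1/2, 2-2H)}`. -/
def eps (H : ℝ) (N : ℕ) : ℝ :=
  Real.log N / (N : ℝ) ^ min (1 / 2) (2 - 2 * H)

/-- `T_N = T^{(1)} ∧ T^{(2)} ∧ (T^{(3)} - 1) ∧ (T^{(4)} - 1)`, where `∞ - 1 = ∞`. -/
def stopTime (H σ : ℝ) (ξ : ℕ → Ω → ℝ) (N : ℕ) (ω : Ω) : ℕ∞ :=
  min (min (dropTime (theta1 H σ ξ) N (eps H N) ω) (dropTime (theta2 H σ ξ) N (eps H N) ω))
    (min (dropTime (theta3 H σ ξ) N (eps H N) ω - 1)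
      (dropTime (theta4 H σ ξ) N (eps H N) ω - 1))

/-- The stopped stock position `1_{k < T_N} φ_k^{1,N}`. -/
def stoppedStock (H σ s₀ : ℝ) (ξ : ℕ → Ω → ℝ) (N k : ℕ) (ω : Ω) : ℝ :=
  if (k : ℕ∞) < stopTime H σ ξ N ω then phiStock H σ s₀ ξ N k ω else 0

/-- `C` is a positive constant with `sup_{1 ≤ n ≤ N} |θ_n| ≤ C N^{H-1/2}` for all `N ≥ 1`. -/
def IsThetaBound [MeasurableSpace Ω] (P : Measure Ω) (H : ℝ) (θ : ℕ → Ω → ℝ) (C : ℝ) : Prop :=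
  0 < C ∧ ∀ N : ℕ, 1 ≤ N → ∀ n ∈ Finset.Icc 1 N, ∀ᵐ ω ∂P, |θ n ω| ≤ C * (N : ℝ) ^ (H - 1 / 2)

/-- `ĉ_N = 4 ε_N + C₁₂ / N^{3/2-H}`. -/
def cHat (H C₁₂ : ℝ) (N : ℕ) : ℝ :=
  4 * eps H N + C₁₂ / (N : ℝ) ^ (3 / 2 - H)

/-- The strategy `ψ^N`: the stopped stock position divided by `√ĉ_N`, with the bond position
given by the frictionless self-financing condition. -/
def psi (H σ s₀ C₁₂ : ℝ) (ξ : ℕ → Ω → ℝ) (N : ℕ) : Strategy Ω :=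
  ofStock (stockPrice H σ s₀ ξ N) 0
    (fun k ω => 1 / √(cHat H C₁₂ N) * stoppedStock H σ s₀ ξ N k ω)

end

end FractionalBinary

/-!
The gain of holding `X_k / S_k` shares during the next period is proportional to `X_k X_{k+1}`, so
the gain of `ψ^N` before `T_N` is the sum of all `θ^{(i)}_k`, divided by `N √ĉ_N`.

The sums of `θ^{(1)}` and `θ^{(2)}` are martingale transforms of the signs with summands of variance
`O(1)`, and so is the sum of `θ^{(3)}` up to a nonnegative diagonal term. By Doob's inequality none
of them falls below `-ε_N N`, except with probability tending to zero. The mean of the sum of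
`θ^{(4)}` grows linearly, because `E[Y_k Y_{k+1}]` is bounded away from zero for large `k`. The
covariance of `Y_k` and `Y_l` is `O(n^{H-1/2} (|k-l|+1)^{H-3/2})` for `k, l ≤ n`, which makes the
variance of this sum `O(n^{2H})`. Chebyshev's inequality and the Borel–Cantelli lemma give its
linear growth along a polynomial subsequence, and the gaps are filled by monotonicity: since
`2 |Y_{k-1} Y_k| ≤ Y_{k-1}² + Y_k²`, the sum becomes monotone in `n` once half the sums of squares
are added, and these are controlled in the same way.

Stopping at `T_N` keeps the average above `-ĉ_N`: `θ^{(1)}` and `θ^{(2)}` overshoot the level `-ε_N`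
by at most one summand, while the sums of the predictable `θ^{(3)}` and `θ^{(4)}` are known one step
ahead. After division by `√ĉ_N` the worst loss is `√ĉ_N → 0`, and the typical gain is of order
`1 / √ĉ_N → ∞`.
-/

open scoped ENNReal

namespace FractionalBinary

/-! ### Kernel coefficients -/

section Kernel

theorem abs_integral_zero_one_le {f : ℝ → ℝ} {r D : ℝ} (hr : -1 < r)
    (hf : ∀ v ∈ Set.Ioc (0 : ℝ) 1, |f v| ≤ D * v ^ r) :
    |∫ v in (0 : ℝ)..1, f v| ≤ D / (r + 1) := by
  have hD : ∫ v in (0 : ℝ)..1, D * v ^ r = D / (r + 1) := by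
    rw [intervalIntegral.integral_const_mul, integral_rpow (.inl hr), Real.one_rpow,
      Real.zero_rpow (by linarith), sub_zero, mul_one_div]
  rw [← hD]
  exact intervalIntegral.norm_integral_le_of_norm_le (f := f) zero_le_one (.of_forall hf)
    ((intervalIntegral.intervalIntegrable_rpow' hr).const_mul D)

theorem abs_integral_rpow_mul_le {F : ℝ → ℝ} {r a B : ℝ} (hr : -1 < r) (hr0 : r ≤ 0)
    (ha : 1 ≤ a) (hF : ∀ x ∈ Set.Ioc (a - 1) a, |F x| ≤ B) :
    |∫ x in (a - 1)..a, x ^ r * F x| ≤ a ^ r * B / (r + 1) := by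
  have hshift : ∫ x in (a - 1)..a, x ^ r * F x
      = ∫ u in (0 : ℝ)..1, (u + (a - 1)) ^ r * F (u + (a - 1)) := by
    rw [intervalIntegral.integral_comp_add_right (fun x => x ^ r * F x)]
    simp
  rw [hshift]
  refine abs_integral_zero_one_le hr fun u ⟨hu0, hu1⟩ => ?_
  have hau : a * u ≤ u + (a - 1) := by nlinarith
  have hpow : (u + (a - 1)) ^ r ≤ a ^ r * u ^ r := by
    rw [← Real.mul_rpow (by positivity) hu0.le]
    exact Real.rpow_le_rpow_of_nonpos (by positivity) hau hr0
  have hpow0 : 0 ≤ (u + (a - 1)) ^ r := Real.rpow_nonneg (by linarith) _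
  calc |(u + (a - 1)) ^ r * F (u + (a - 1))|
      = (u + (a - 1)) ^ r * |F (u + (a - 1))| := by rw [abs_mul, abs_of_nonneg hpow0]
    _ ≤ (a ^ r * u ^ r) * B := by
        gcongr
        exact hF _ ⟨by linarith, by linarith⟩
    _ = a ^ r * B * u ^ r := by ring

theorem mul_le_integral_integral_of_continuousOn {f : ℝ → ℝ → ℝ} {a b c d m : ℝ}
    (hab : a ≤ b) (hcd : c ≤ d)
    (hf : ContinuousOn (Function.uncurry f) (Set.Icc a b ×ˢ Set.Icc c d))
    (hm : ∀ x ∈ Set.Icc a b, ∀ y ∈ Set.Icc c d, m ≤ f x y) :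
    m * (d - c) * (b - a) ≤ ∫ x in a..b, ∫ y in c..d, f x y := by
  have hinner : ∀ x ∈ Set.Icc a b, m * (d - c) ≤ ∫ y in c..d, f x y := by
    intro x hx
    have hfx : ContinuousOn (f x) (Set.Icc c d) :=
      hf.comp (f := fun y => (x, y)) (by fun_prop) fun y hy => ⟨hx, hy⟩
    simpa [mul_comm] using intervalIntegral.integral_mono_on hcd intervalIntegrable_const
      (hfx.intervalIntegrable_of_Icc (μ := volume) hcd) (hm x hx)
  have houter : IntervalIntegrable (fun x => ∫ y in c..d, f x y) volume a b := by
    have hfint : IntegrableOn (Function.uncurry f) (Set.Icc a b ×ˢ Set.Icc c d)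
        (volume.prod volume) :=
      hf.integrableOn_compact (isCompact_Icc.prod isCompact_Icc)
    rw [IntegrableOn, ← Measure.prod_restrict] at hfint
    rw [intervalIntegrable_iff_integrableOn_Icc_of_le hab]
    refine hfint.integral_prod_left.congr (.of_forall fun x => ?_)
    simp only [intervalIntegral.integral_of_le hcd, integral_Icc_eq_integral_Ioc,
      Function.uncurry_apply_pair]
  simpa only [intervalIntegral.integral_const, smul_eq_mul, mul_comm (b - a)] using
    intervalIntegral.integral_mono_on hab intervalIntegrable_const houter hinner

variable {H σ : ℝ}

theorem kernelConst_nonneg (hH : 1 / 2 ≤ H) : 0 ≤ kernelConst H :=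
  mul_nonneg (sub_nonneg.2 hH) (Real.sqrt_nonneg _)

theorem kernelConst_pos (hH : 1 / 2 < H) (hH1 : H < 1) : 0 < kernelConst H :=
  mul_pos (sub_pos.2 hH) (Real.sqrt_pos.2 (div_pos
    (mul_pos (by linarith) (Real.Gamma_pos_of_pos (by linarith)))
    (mul_pos (Real.Gamma_pos_of_pos (by linarith)) (Real.Gamma_pos_of_pos (by linarith)))))

theorem jCoef_nonneg (hH : 1 / 2 ≤ H) (hσ : 0 ≤ σ) {n i : ℕ} (hi : 1 ≤ i) (hin : i < n) :
    0 ≤ jCoef H σ n i := by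
  have hi' : (1 : ℝ) ≤ i := by exact_mod_cast hi
  have hin' : (i : ℝ) + 1 ≤ n := by exact_mod_cast hin
  refine mul_nonneg (mul_nonneg hσ (kernelConst_nonneg hH))
    (intervalIntegral.integral_nonneg (by linarith) fun x hx => ?_)
  refine mul_nonneg (Real.rpow_nonneg (by linarith [hx.1]) _)
    (intervalIntegral.integral_nonneg zero_le_one fun v hv => ?_)
  exact mul_nonneg (Real.rpow_nonneg (by linarith [hv.1]) _)
    (Real.rpow_nonneg (by linarith [hv.1, hx.2]) _)

theorem gCoef_nonneg (hH : 1 / 2 ≤ H) (hσ : 0 ≤ σ) (n : ℕ) : 0 ≤ gCoef H σ n := by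
  unfold gCoef
  split_ifs with hn
  · exact le_rfl
  have hn' : (1 : ℝ) ≤ n := by exact_mod_cast Nat.one_le_iff_ne_zero.2 hn
  refine mul_nonneg (mul_nonneg hσ (kernelConst_nonneg hH))
    (intervalIntegral.integral_nonneg (by linarith) fun x hx => ?_)
  refine mul_nonneg (mul_nonneg (Real.rpow_nonneg (by linarith [hx.1]) _)
    (Real.rpow_nonneg (by linarith [hx.2]) _))
    (intervalIntegral.integral_nonneg zero_le_one fun y hy => ?_)
  have hyx : 0 ≤ y * (n - x) := mul_nonneg hy.1 (sub_nonneg.2 hx.2)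
  exact mul_nonneg (Real.rpow_nonneg (by linarith [hx.1]) _) (Real.rpow_nonneg hy.1 _)

/-- The common constant in the upper bounds for `j_n(i)` and `g_n`. -/
noncomputable def coefBound (H σ : ℝ) : ℝ :=
  σ * kernelConst H / (H - 1 / 2) / (3 / 2 - H)

theorem coefBound_nonneg (hH : 1 / 2 ≤ H) (hH1 : H < 1) (hσ : 0 ≤ σ) : 0 ≤ coefBound H σ :=
  div_nonneg (div_nonneg (mul_nonneg hσ (kernelConst_nonneg hH)) (by linarith)) (by linarith)

theorem jCoef_le (hH : 1 / 2 < H) (hH1 : H < 1) (hσ : 0 ≤ σ) {n i : ℕ}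
    (hi : 1 ≤ i) (hin : i < n) :
    jCoef H σ n i ≤ coefBound H σ *
      ((n : ℝ) ^ (H - 1 / 2) * (i : ℝ) ^ (1 / 2 - H) * ((n - i : ℕ) : ℝ) ^ (H - 3 / 2)) := by
  have hi' : (1 : ℝ) ≤ i := by exact_mod_cast hi
  have hin' : (i : ℝ) + 1 ≤ n := by exact_mod_cast hin
  rw [Nat.cast_sub hin.le]
  set D : ℝ := (n : ℝ) ^ (H - 1 / 2) * ((n : ℝ) - i) ^ (H - 3 / 2) with hD
  have hinner : ∀ x ∈ Set.Ioc ((i : ℝ) - 1) i,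
      |∫ v in (0 : ℝ)..1, (v + n - 1) ^ (H - 1 / 2) * (v + n - 1 - x) ^ (H - 3 / 2)|
        ≤ D / (H - 3 / 2 + 1) := by
    refine fun x ⟨_, hx⟩ => abs_integral_zero_one_le (by linarith) fun v ⟨hv0, hv1⟩ => ?_
    have hn : 0 ≤ v + n - 1 := by linarith
    have hvx : ((n : ℝ) - i) * v ≤ v + n - 1 - x := by nlinarith
    have hv : 0 < ((n : ℝ) - i) * v := mul_pos (by linarith) hv0
    rw [abs_of_nonneg (mul_nonneg (Real.rpow_nonneg hn _)
      (Real.rpow_nonneg (hv.le.trans hvx) _)), hD, mul_assoc,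
      ← Real.mul_rpow (by linarith) hv0.le]
    exact mul_le_mul (Real.rpow_le_rpow hn (by linarith) (by linarith))
      (Real.rpow_le_rpow_of_nonpos hv hvx (by linarith))
      (Real.rpow_nonneg (hv.le.trans hvx) _) (by positivity)
  calc jCoef H σ n i
      ≤ σ * kernelConst H *
          ((i : ℝ) ^ (1 / 2 - H) * (D / (H - 3 / 2 + 1)) / (1 / 2 - H + 1)) :=
        mul_le_mul_of_nonneg_left ((le_abs_self _).trans
          (abs_integral_rpow_mul_le (by linarith) (by linarith) hi' hinner))
          (mul_nonneg hσ (kernelConst_nonneg hH.le))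
    _ = _ := by
        rw [hD, coefBound, show H - 3 / 2 + 1 = H - 1 / 2 by ring,
          show 1 / 2 - H + 1 = 3 / 2 - H by ring]
        ring

theorem gCoef_le (hH : 1 / 2 < H) (hH1 : H < 1) (hσ : 0 ≤ σ) (n : ℕ) :
    gCoef H σ n ≤ coefBound H σ := by
  unfold gCoef
  split_ifs with hn
  · exact coefBound_nonneg hH.le hH1 hσ
  have hn' : (1 : ℝ) ≤ n := by exact_mod_cast Nat.one_le_iff_ne_zero.2 hn
  have hinner : ∀ x ∈ Set.Ioc ((n : ℝ) - 1) n, |((n : ℝ) - x) ^ (H - 1 / 2) *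
      ∫ y in (0 : ℝ)..1, (y * (n - x) + x) ^ (H - 1 / 2) * y ^ (H - 3 / 2)|
        ≤ (n : ℝ) ^ (H - 1 / 2) / (H - 3 / 2 + 1) := by
    intro x ⟨hx0, hx1⟩
    have hnx : 0 ≤ n - x := sub_nonneg.2 hx1
    rw [abs_mul, abs_of_nonneg (Real.rpow_nonneg hnx _), ← one_mul (_ ^ _ / _)]
    refine mul_le_mul (Real.rpow_le_one hnx (by linarith) (by linarith))
      (abs_integral_zero_one_le (by linarith) fun y ⟨hy0, hy1⟩ => ?_) (abs_nonneg _) zero_le_one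
    have hyx : 0 ≤ y * (n - x) + x := by linarith [mul_nonneg hy0.le hnx]
    have hyn : y * (n - x) + x ≤ n := by nlinarith
    rw [abs_of_nonneg (mul_nonneg (Real.rpow_nonneg hyx _) (Real.rpow_nonneg hy0.le _))]
    gcongr
  have hcancel : (n : ℝ) ^ (1 / 2 - H) * (n : ℝ) ^ (H - 1 / 2) = 1 := by
    rw [← Real.rpow_add (by linarith)]
    simp
  simp only [mul_assoc ((_ : ℝ) ^ (1 / 2 - H))]
  calc _ ≤ σ * kernelConst H * ((n : ℝ) ^ (1 / 2 - H) *
          ((n : ℝ) ^ (H - 1 / 2) / (H - 3 / 2 + 1)) / (1 / 2 - H + 1)) :=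
        mul_le_mul_of_nonneg_left ((le_abs_self _).trans
          (abs_integral_rpow_mul_le (by linarith) (by linarith) hn' hinner))
          (mul_nonneg hσ (kernelConst_nonneg hH.le))
    _ = coefBound H σ := by
        rw [← mul_div_assoc ((n : ℝ) ^ _), hcancel, coefBound,
          show H - 3 / 2 + 1 = H - 1 / 2 by ring, show 1 / 2 - H + 1 = 3 / 2 - H by ring]
        ring

theorem le_jCoef (hH : 1 / 2 ≤ H) (hH1 : H < 1) (hσ : 0 ≤ σ) {n i : ℕ} (hi : 2 ≤ i)
    (hin : i + 2 ≤ n) :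
    σ * kernelConst H * ((n : ℝ) - i + 1) ^ (H - 3 / 2) ≤ jCoef H σ n i := by
  have hi' : (2 : ℝ) ≤ i := by exact_mod_cast hi
  have hin' : (i : ℝ) + 2 ≤ n := by exact_mod_cast hin
  refine mul_le_mul_of_nonneg_left ?_ (mul_nonneg hσ (kernelConst_nonneg hH))
  simp only [← intervalIntegral.integral_const_mul]
  have hcont : ContinuousOn (Function.uncurry fun x v : ℝ => x ^ (1 / 2 - H) *
      ((v + n - 1) ^ (H - 1 / 2) * (v + n - 1 - x) ^ (H - 3 / 2)))
      (Set.Icc ((i : ℝ) - 1) i ×ˢ Set.Icc 0 1) := by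
    simp only [Function.uncurry_def]
    refine ContinuousOn.mul (ContinuousOn.rpow_const (by fun_prop) ?_)
      (ContinuousOn.mul (ContinuousOn.rpow_const (by fun_prop) ?_)
        (ContinuousOn.rpow_const (by fun_prop) ?_))
    all_goals
      rintro ⟨x, v⟩ ⟨⟨hx0, hx1⟩, hv0, -⟩
      refine .inl (ne_of_gt ?_)
      dsimp only at *
      linarith
  have hlow : ∀ x ∈ Set.Icc ((i : ℝ) - 1) i, ∀ v ∈ Set.Icc (0 : ℝ) 1,
      ((n : ℝ) - i + 1) ^ (H - 3 / 2) ≤ x ^ (1 / 2 - H) *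
        ((v + n - 1) ^ (H - 1 / 2) * (v + n - 1 - x) ^ (H - 3 / 2)) := by
    intro x ⟨hx0, hx1⟩ v ⟨hv0, hv1⟩
    have hx : 0 < x := by linarith
    have hone : 1 ≤ x ^ (1 / 2 - H) * (v + n - 1) ^ (H - 1 / 2) :=
      calc 1 = x ^ (1 / 2 - H) * x ^ (H - 1 / 2) := by
            rw [← Real.rpow_add hx]
            simp
        _ ≤ x ^ (1 / 2 - H) * (v + n - 1) ^ (H - 1 / 2) := by
            gcongr
            linarith
    have hdist : ((n : ℝ) - i + 1) ^ (H - 3 / 2) ≤ (v + n - 1 - x) ^ (H - 3 / 2) :=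
      Real.rpow_le_rpow_of_nonpos (by linarith) (by linarith) (by linarith)
    rw [← mul_assoc, ← one_mul (((n : ℝ) - i + 1) ^ (H - 3 / 2))]
    exact mul_le_mul hone hdist (Real.rpow_nonneg (by linarith) _) (by linarith)
  simpa using mul_le_integral_integral_of_continuousOn (by linarith) zero_le_one hcont hlow

end Kernel

/-! ### Sums of powers and of kernel coefficients -/

section PowerSums

variable {r s : ℝ}

theorem mul_rpow_le_rpow_sub_rpow {x : ℝ} (hr : -1 ≤ r) (hr0 : r ≤ 0) (hx : 1 ≤ x) :
    (r + 1) * x ^ r ≤ x ^ (r + 1) - (x - 1) ^ (r + 1) := by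
  have hx0 : 0 < x := by linarith
  have hinv : 1 / x ≤ 1 := (div_le_one hx0).2 hx
  have hbernoulli : (1 + -(1 / x)) ^ (r + 1) ≤ 1 + (r + 1) * -(1 / x) :=
    rpow_one_add_le_one_add_mul_self (by linarith) (by linarith) (by linarith)
  have hle : (x - 1) ^ (r + 1) ≤ x ^ (r + 1) - (r + 1) * x ^ r :=
    calc (x - 1) ^ (r + 1) = x ^ (r + 1) * (1 + -(1 / x)) ^ (r + 1) := by
          rw [← Real.mul_rpow hx0.le (by linarith)]
          congr 1
          field_simp
          ring
      _ ≤ x ^ (r + 1) * (1 + (r + 1) * -(1 / x)) := by gcongr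
      _ = x ^ (r + 1) - (r + 1) * x ^ r := by
          rw [Real.rpow_add hx0, Real.rpow_one]
          field_simp
          ring
  linarith

theorem sum_rpow_le (hr : -1 < r) (hr0 : r ≤ 0) (n : ℕ) :
    ∑ m ∈ Finset.Icc 1 n, (m : ℝ) ^ r ≤ (n : ℝ) ^ (r + 1) / (r + 1) := by
  have hr1 : 0 < r + 1 := by linarith
  induction n with
  | zero => simp [Real.zero_rpow hr1.ne']
  | succ n ih =>
    have hdiff := mul_rpow_le_rpow_sub_rpow hr.le hr0 (x := ((n + 1 : ℕ) : ℝ)) (by simp)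
    rw [le_div_iff₀ hr1] at ih ⊢
    rw [Finset.sum_Icc_succ_top (by lia), add_mul]
    rw [Nat.cast_add_one, add_sub_cancel_right] at *
    linarith

theorem sum_rpow_mul_rpow_le (hr : r ≤ 0) (hs : s ≤ 0) (n : ℕ) :
    ∑ i ∈ Finset.Ico 1 n, (i : ℝ) ^ r * ((n - i : ℕ) : ℝ) ^ s
      ≤ ((n : ℝ) / 2) ^ r * ∑ m ∈ Finset.Ico 1 n, (m : ℝ) ^ s
        + ((n : ℝ) / 2) ^ s * ∑ m ∈ Finset.Ico 1 n, (m : ℝ) ^ r := by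
  have hreflect : ∑ m ∈ Finset.Ico 1 n, (m : ℝ) ^ s
      = ∑ i ∈ Finset.Ico 1 n, ((n - i : ℕ) : ℝ) ^ s := by
    rw [Finset.sum_Ico_reflect (fun m : ℕ => (m : ℝ) ^ s) 1 (Nat.le_succ n)]
    simp
  rw [hreflect, Finset.mul_sum, Finset.mul_sum, ← Finset.sum_add_distrib]
  refine Finset.sum_le_sum fun i hi => ?_
  rw [Finset.mem_Ico] at hi
  have hn : (0 : ℝ) < (n : ℝ) / 2 := by
    have : 0 < n := by lia
    positivity
  -- One of the two factors has its base at least `n / 2`.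
  rcases le_total ((n : ℝ) / 2) i with hle | hle
  · refine le_add_of_le_of_nonneg ?_ (by positivity)
    exact mul_le_mul_of_nonneg_right (Real.rpow_le_rpow_of_nonpos hn hle hr) (by positivity)
  · refine le_add_of_nonneg_of_le (by positivity) ?_
    rw [mul_comm]
    refine mul_le_mul_of_nonneg_right (Real.rpow_le_rpow_of_nonpos hn ?_ hs) (by positivity)
    rw [Nat.cast_sub hi.2.le]
    linarith

theorem sum_Ico_rpow_le (hr : -1 < r) (hr0 : r ≤ 0) (n : ℕ) :
    ∑ m ∈ Finset.Ico 1 n, (m : ℝ) ^ r ≤ (n : ℝ) ^ (r + 1) / (r + 1) :=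
  (Finset.sum_le_sum_of_subset_of_nonneg Finset.Ico_subset_Icc_self
    fun _ _ _ => by positivity).trans (sum_rpow_le hr hr0 n)

theorem exists_sum_rpow_mul_rpow_le (hr : -1 < r) (hr0 : r ≤ 0) (hs : -1 < s) (hs0 : s ≤ 0) :
    ∃ C : ℝ, 0 ≤ C ∧ ∀ n : ℕ,
      ∑ i ∈ Finset.Ico 1 n, (i : ℝ) ^ r * ((n - i : ℕ) : ℝ) ^ s ≤ C * (n : ℝ) ^ (r + s + 1) := by
  have hr1 : 0 < r + 1 := by linarith
  have hs1 : 0 < s + 1 := by linarith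
  refine ⟨1 / 2 ^ r / (s + 1) + 1 / 2 ^ s / (r + 1), by positivity, fun n => ?_⟩
  rcases n.eq_zero_or_pos with rfl | hn
  · simp only [zero_le, Finset.Ico_eq_empty_of_le, Finset.sum_empty]
    positivity
  have hn' : (0 : ℝ) < n := by exact_mod_cast hn
  calc _ ≤ ((n : ℝ) / 2) ^ r * ((n : ℝ) ^ (s + 1) / (s + 1))
        + ((n : ℝ) / 2) ^ s * ((n : ℝ) ^ (r + 1) / (r + 1)) := by
        refine (sum_rpow_mul_rpow_le hr0 hs0 n).trans ?_
        gcongr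
        · exact sum_Ico_rpow_le hs hs0 n
        · exact sum_Ico_rpow_le hr hr0 n
    _ = _ := by
        rw [Real.div_rpow hn'.le zero_le_two, Real.div_rpow hn'.le zero_le_two,
          Real.rpow_add hn', Real.rpow_add hn', Real.rpow_add hn', Real.rpow_add hn']
        ring

theorem exists_sum_rpow_mul_rpow_le_of_lt_neg_one (hr : -1 < r) (hr0 : r ≤ 0) (hs : s < -1) :
    ∃ C : ℝ, 0 ≤ C ∧ ∀ n : ℕ,
      ∑ i ∈ Finset.Ico 1 n, (i : ℝ) ^ r * ((n - i : ℕ) : ℝ) ^ s ≤ C * (n : ℝ) ^ r := by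
  have hr1 : 0 < r + 1 := by linarith
  have hsum : Summable fun m : ℕ => (m : ℝ) ^ s := Real.summable_nat_rpow.2 hs
  refine ⟨1 / 2 ^ r * ∑' m : ℕ, (m : ℝ) ^ s + 1 / 2 ^ s / (r + 1), by positivity, fun n => ?_⟩
  rcases n.eq_zero_or_pos with rfl | hn
  · simp only [zero_le, Finset.Ico_eq_empty_of_le, Finset.sum_empty]
    positivity
  have hn' : (0 : ℝ) < n := by exact_mod_cast hn
  have hdecay : (n : ℝ) ^ (s + 1) ≤ 1 :=
    Real.rpow_le_one_of_one_le_of_nonpos (by exact_mod_cast hn) (by linarith)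
  calc _ ≤ ((n : ℝ) / 2) ^ r * ∑' m : ℕ, (m : ℝ) ^ s
        + ((n : ℝ) / 2) ^ s * ((n : ℝ) ^ (r + 1) / (r + 1)) := by
        refine (sum_rpow_mul_rpow_le hr0 (by linarith) n).trans ?_
        gcongr
        · exact hsum.sum_le_tsum _ fun m _ => by positivity
        · exact sum_Ico_rpow_le hr hr0 n
    _ = (1 / 2 ^ r * ∑' m : ℕ, (m : ℝ) ^ s) * (n : ℝ) ^ r
        + 1 / 2 ^ s / (r + 1) * (n : ℝ) ^ r * (n : ℝ) ^ (s + 1) := by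
        rw [Real.div_rpow hn'.le zero_le_two, Real.div_rpow hn'.le zero_le_two,
          Real.rpow_add hn', Real.rpow_add hn']
        ring
    _ ≤ _ := by
        rw [add_mul]
        exact add_le_add_right (mul_le_of_le_one_right (by positivity) hdecay) _

variable {H σ : ℝ}

theorem exists_sum_jCoef_le (hH : 1 / 2 < H) (hH1 : H < 1) (hσ : 0 ≤ σ) :
    ∃ C : ℝ, 0 ≤ C ∧ ∀ n : ℕ,
      ∑ i ∈ Finset.Ico 1 n, jCoef H σ n i ≤ C * (n : ℝ) ^ (H - 1 / 2) := by
  obtain ⟨C, hC, hsum⟩ := exists_sum_rpow_mul_rpow_le (r := 1 / 2 - H) (s := H - 3 / 2)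
    (by linarith) (by linarith) (by linarith) (by linarith)
  have hB := coefBound_nonneg hH.le hH1 hσ
  refine ⟨coefBound H σ * C, by positivity, fun n => ?_⟩
  calc ∑ i ∈ Finset.Ico 1 n, jCoef H σ n i
      ≤ ∑ i ∈ Finset.Ico 1 n, coefBound H σ * (n : ℝ) ^ (H - 1 / 2) *
          ((i : ℝ) ^ (1 / 2 - H) * ((n - i : ℕ) : ℝ) ^ (H - 3 / 2)) := by
        refine Finset.sum_le_sum fun i hi => ?_
        obtain ⟨hi1, hin⟩ := Finset.mem_Ico.1 hi
        exact (jCoef_le hH hH1 hσ hi1 hin).trans_eq (by ring)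
    _ ≤ coefBound H σ * (n : ℝ) ^ (H - 1 / 2) * (C * (n : ℝ) ^ (1 / 2 - H + (H - 3 / 2) + 1)) := by
        rw [← Finset.mul_sum]
        gcongr
        exact hsum n
    _ = coefBound H σ * C * (n : ℝ) ^ (H - 1 / 2) := by
        rw [show 1 / 2 - H + (H - 3 / 2) + 1 = 0 by ring, Real.rpow_zero]
        ring

theorem rpow_mul_rpow_neg_le_one {x : ℝ} (hx : 0 ≤ x) (r : ℝ) : x ^ r * x ^ (-r) ≤ 1 := by
  rw [Real.rpow_neg hx]
  exact mul_inv_le_one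

theorem exists_sum_jCoef_sq_le (hH : 1 / 2 < H) (hH1 : H < 1) (hσ : 0 ≤ σ) :
    ∃ C : ℝ, 0 ≤ C ∧ ∀ n : ℕ, ∑ i ∈ Finset.Ico 1 n, jCoef H σ n i ^ 2 ≤ C := by
  obtain ⟨C, hC, hsum⟩ := exists_sum_rpow_mul_rpow_le_of_lt_neg_one (r := (1 / 2 - H) * 2)
    (s := (H - 3 / 2) * 2) (by linarith) (by linarith) (by linarith)
  refine ⟨coefBound H σ ^ 2 * C, by positivity, fun n => ?_⟩
  calc ∑ i ∈ Finset.Ico 1 n, jCoef H σ n i ^ 2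
      ≤ ∑ i ∈ Finset.Ico 1 n, coefBound H σ ^ 2 * (n : ℝ) ^ ((H - 1 / 2) * 2) *
          ((i : ℝ) ^ ((1 / 2 - H) * 2) * ((n - i : ℕ) : ℝ) ^ ((H - 3 / 2) * 2)) := by
        refine Finset.sum_le_sum fun i hi => ?_
        obtain ⟨hi1, hin⟩ := Finset.mem_Ico.1 hi
        refine (pow_le_pow_left₀ (jCoef_nonneg hH.le hσ hi1 hin)
          (jCoef_le hH hH1 hσ hi1 hin) 2).trans_eq ?_
        have hsq : ∀ (m : ℕ) (t : ℝ), (m : ℝ) ^ (t * 2) = ((m : ℝ) ^ t) ^ 2 := fun m t => by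
          exact_mod_cast Real.rpow_mul_natCast m.cast_nonneg t 2
        rw [hsq, hsq, hsq]
        ring
    _ ≤ coefBound H σ ^ 2 * (n : ℝ) ^ ((H - 1 / 2) * 2) * (C * (n : ℝ) ^ ((1 / 2 - H) * 2)) := by
        rw [← Finset.mul_sum]
        gcongr
        exact hsum n
    _ = coefBound H σ ^ 2 * C * ((n : ℝ) ^ ((H - 1 / 2) * 2) * (n : ℝ) ^ (-((H - 1 / 2) * 2))) := by
        rw [show (1 / 2 - H) * 2 = -((H - 1 / 2) * 2) by ring]
        ring
    _ ≤ coefBound H σ ^ 2 * C :=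
        mul_le_of_le_one_right (by positivity) (rpow_mul_rpow_neg_le_one n.cast_nonneg _)

theorem exists_sum_jCoef_mul_jCoef_le (hH : 1 / 2 < H) (hH1 : H < 1) (hσ : 0 ≤ σ) :
    ∃ C : ℝ, 0 ≤ C ∧ ∀ k l : ℕ, k ≤ l →
      ∑ i ∈ Finset.Ico 1 k, jCoef H σ k i * jCoef H σ l i
        ≤ C * (l : ℝ) ^ (H - 1 / 2) * ((l - k + 1 : ℕ) : ℝ) ^ (H - 3 / 2) := by
  obtain ⟨C, hC, hsum⟩ := exists_sum_rpow_mul_rpow_le (r := (1 / 2 - H) * 2) (s := H - 3 / 2)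
    (by linarith) (by linarith) (by linarith) (by linarith)
  have hB := coefBound_nonneg hH.le hH1 hσ
  refine ⟨coefBound H σ ^ 2 * C, by positivity, fun k l hkl => ?_⟩
  set D : ℝ := coefBound H σ ^ 2 * (l : ℝ) ^ (H - 1 / 2) * ((l - k + 1 : ℕ) : ℝ) ^ (H - 3 / 2)
    with hD
  calc ∑ i ∈ Finset.Ico 1 k, jCoef H σ k i * jCoef H σ l i
      ≤ ∑ i ∈ Finset.Ico 1 k, D * (k : ℝ) ^ (H - 1 / 2) *
          ((i : ℝ) ^ ((1 / 2 - H) * 2) * ((k - i : ℕ) : ℝ) ^ (H - 3 / 2)) := by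
        refine Finset.sum_le_sum fun i hi => ?_
        obtain ⟨hi1, hik⟩ := Finset.mem_Ico.1 hi
        have hil : i < l := hik.trans_le hkl
        have hdist : ((l - i : ℕ) : ℝ) ^ (H - 3 / 2) ≤ ((l - k + 1 : ℕ) : ℝ) ^ (H - 3 / 2) :=
          Real.rpow_le_rpow_of_nonpos (by positivity)
            (by exact_mod_cast (by lia : l - k + 1 ≤ l - i)) (by linarith)
        have hil' : jCoef H σ l i ≤ coefBound H σ * ((l : ℝ) ^ (H - 1 / 2) *
            (i : ℝ) ^ (1 / 2 - H) * ((l - k + 1 : ℕ) : ℝ) ^ (H - 3 / 2)) :=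
          (jCoef_le hH hH1 hσ hi1 hil).trans (by gcongr)
        refine (mul_le_mul (jCoef_le hH hH1 hσ hi1 hik) hil' (jCoef_nonneg hH.le hσ hi1 hil)
          (by positivity)).trans_eq ?_
        have hsq : (i : ℝ) ^ ((1 / 2 - H) * 2) = ((i : ℝ) ^ (1 / 2 - H)) ^ 2 := by
          exact_mod_cast Real.rpow_mul_natCast i.cast_nonneg (1 / 2 - H) 2
        rw [hsq]
        ring
    _ ≤ D * (k : ℝ) ^ (H - 1 / 2) * (C * (k : ℝ) ^ ((1 / 2 - H) * 2 + (H - 3 / 2) + 1)) := by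
        rw [← Finset.mul_sum]
        gcongr
        exact hsum k
    _ = D * C * ((k : ℝ) ^ (H - 1 / 2) * (k : ℝ) ^ (-(H - 1 / 2))) := by
        rw [show (1 / 2 - H) * 2 + (H - 3 / 2) + 1 = -(H - 1 / 2) by ring]
        ring
    _ ≤ D * C := mul_le_of_le_one_right (by positivity) (rpow_mul_rpow_neg_le_one k.cast_nonneg _)
    _ = _ := by
        rw [hD]
        ring

end PowerSums

/-! ### Martingale transforms of fair signs -/

section Signs

variable {Ω : Type*} {ξ Z : ℕ → Ω → ℝ}

theorem info_mono : Monotone (info ξ) :=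
  fun _ _ h => biSup_mono fun _ hi => Finset.Icc_subset_Icc_right h hi

theorem measurable_info {i n : ℕ} (hi : 1 ≤ i) (hin : i ≤ n) : Measurable[info ξ n] (ξ i) :=
  (comap_measurable (ξ i)).mono
    (le_biSup (fun i => MeasurableSpace.comap (ξ i) inferInstance) (Finset.mem_Icc.2 ⟨hi, hin⟩))
    le_rfl

/-- The martingale transform `∑_{k=1}^n ξ_k Z_k`. -/
def transform (ξ Z : ℕ → Ω → ℝ) (n : ℕ) (ω : Ω) : ℝ :=
  ∑ k ∈ Finset.Icc 1 n, ξ k ω * Z k ω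

theorem transform_succ (n : ℕ) (ω : Ω) :
    transform ξ Z (n + 1) ω = transform ξ Z n ω + ξ (n + 1) ω * Z (n + 1) ω :=
  Finset.sum_Icc_succ_top (by lia) _

variable [MeasurableSpace Ω] {P : Measure Ω}

/-- `Z` is a predictable integrand: `Z k` is a function of `ξ 1, …, ξ (k - 1)`, and it is
essentially bounded, with a bound that may depend on `k`. The value `Z 0` plays no role. -/
structure IsBoundedPredictable (P : Measure Ω) (ξ Z : ℕ → Ω → ℝ) : Prop where
  measurable : ∀ k, 1 ≤ k → Measurable[info ξ (k - 1)] (Z k)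
  memLp_top : ∀ k, 1 ≤ k → MemLp (Z k) ∞ P

theorem IsBoundedPredictable.measurable_transform (hZ : IsBoundedPredictable P ξ Z) (n : ℕ) :
    Measurable[info ξ n] (transform ξ Z n) := by
  refine Finset.measurable_fun_sum _ fun k hk => ?_
  obtain ⟨hk1, hkn⟩ := Finset.mem_Icc.1 hk
  exact (measurable_info hk1 hkn).mul ((hZ.measurable k hk1).mono (info_mono (by lia)) le_rfl)

namespace IsFairSignSequence

theorem info_le (hξ : IsFairSignSequence P ξ) (n : ℕ) : info ξ n ≤ ‹MeasurableSpace Ω› :=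
  iSup₂_le fun i hi => (hξ.measurable i (Finset.mem_Icc.1 hi).1).comap_le

/-- The filtration `F_n = σ(ξ 1, …, ξ n)`. -/
def filtration (hξ : IsFairSignSequence P ξ) : Filtration ℕ ‹MeasurableSpace Ω› where
  seq := info ξ
  mono' := info_mono
  le' := hξ.info_le

theorem indep_comap_succ_info (hξ : IsFairSignSequence P ξ) (n : ℕ) :
    Indep (MeasurableSpace.comap (ξ (n + 1)) inferInstance) (info ξ n) P := by
  have hindep : Indep (⨆ i ∈ ({n} : Set ℕ), MeasurableSpace.comap (ξ (i + 1)) inferInstance)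
      (⨆ i ∈ Set.Iio n, MeasurableSpace.comap (ξ (i + 1)) inferInstance) P :=
    indep_iSup_of_disjoint (fun i => (hξ.measurable (i + 1) (by lia)).comap_le)
      hξ.indep.iIndep (by simp)
  have hle : info ξ n ≤
      ⨆ i ∈ Set.Iio n, MeasurableSpace.comap (ξ (i + 1)) inferInstance := by
    refine iSup₂_le fun i hi => ?_
    obtain ⟨hi1, hin⟩ := Finset.mem_Icc.1 hi
    have hmem : i - 1 ∈ Set.Iio n := Set.mem_Iio.2 (by lia)
    simpa only [Nat.sub_add_cancel hi1] using
      le_biSup (fun i => MeasurableSpace.comap (ξ (i + 1)) inferInstance) hmem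
  rw [iSup_singleton] at hindep
  exact indep_of_indep_of_le_right hindep hle

variable [IsProbabilityMeasure P]

theorem ae_eq_one_or (hξ : IsFairSignSequence P ξ) :
    ∀ᵐ ω ∂P, ∀ i, 1 ≤ i → ξ i ω = 1 ∨ ξ i ω = -1 := by
  refine ae_all_iff.2 fun i => ?_
  by_cases hi : 1 ≤ i
  swap
  · exact .of_forall fun ω h => absurd h hi
  have hm1 : MeasurableSet {ω | ξ i ω = 1} := hξ.measurable i hi (measurableSet_singleton 1)
  have hm2 : MeasurableSet {ω | ξ i ω = -1} := hξ.measurable i hi (measurableSet_singleton (-1))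
  have hdisj : Disjoint {ω | ξ i ω = 1} {ω | ξ i ω = -1} :=
    Set.disjoint_left.2 fun ω (h1 : ξ i ω = 1) (h2 : ξ i ω = -1) => by linarith
  have hunion : P ({ω | ξ i ω = 1} ∪ {ω | ξ i ω = -1}) = 1 := by
    rw [measure_union hdisj hm2, hξ.prob_one i hi, hξ.prob_neg_one i hi, ENNReal.add_halves]
  filter_upwards [(mem_ae_iff_prob_eq_one (hm1.union hm2)).2 hunion] with ω hω _ using hω

theorem ae_abs_eq (hξ : IsFairSignSequence P ξ) : ∀ᵐ ω ∂P, ∀ i, 1 ≤ i → |ξ i ω| = 1 := by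
  filter_upwards [hξ.ae_eq_one_or] with ω h i hi
  rcases h i hi with h | h <;> simp [h]

theorem memLp_top (hξ : IsFairSignSequence P ξ) {i : ℕ} (hi : 1 ≤ i) : MemLp (ξ i) ∞ P := by
  refine memLp_top_of_bound (hξ.measurable i hi).aestronglyMeasurable 1 ?_
  filter_upwards [hξ.ae_abs_eq] with ω h using (h i hi).le

theorem isBoundedPredictable_sum (hξ : IsFairSignSequence P ξ) (c : ℕ → ℕ → ℝ) :
    IsBoundedPredictable P ξ fun k ω => ∑ i ∈ Finset.Icc 1 (k - 1), c k i * ξ i ω where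
  measurable _ _ := Finset.measurable_fun_sum _ fun _ hi =>
    measurable_const.mul (measurable_info (Finset.mem_Icc.1 hi).1 (Finset.mem_Icc.1 hi).2)
  memLp_top k _ := memLp_finsetSum _ fun i hi =>
    (hξ.memLp_top (Finset.mem_Icc.1 hi).1).const_mul (c k i)

theorem memLp_top_transform (hξ : IsFairSignSequence P ξ) (hZ : IsBoundedPredictable P ξ Z)
    (n : ℕ) : MemLp (transform ξ Z n) ∞ P :=
  memLp_finsetSum _ fun k hk =>
    (hZ.memLp_top k (Finset.mem_Icc.1 hk).1).mul' (hξ.memLp_top (Finset.mem_Icc.1 hk).1)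

theorem integral_eq_zero (hξ : IsFairSignSequence P ξ) {i : ℕ} (hi : 1 ≤ i) :
    ∫ ω, ξ i ω ∂P = 0 := by
  have hm1 : MeasurableSet {ω | ξ i ω = 1} := hξ.measurable i hi (measurableSet_singleton 1)
  have hm2 : MeasurableSet {ω | ξ i ω = -1} := hξ.measurable i hi (measurableSet_singleton (-1))
  have hdecomp : ξ i =ᵐ[P] fun ω => Set.indicator {ω | ξ i ω = 1} (fun _ => (1 : ℝ)) ω
      - Set.indicator {ω | ξ i ω = -1} (fun _ => (1 : ℝ)) ω := by
    filter_upwards [hξ.ae_eq_one_or] with ω hω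
    rcases hω i hi with h | h <;> simp [Set.indicator, h] <;> norm_num
  rw [integral_congr_ae hdecomp, integral_sub ((integrable_const 1).indicator hm1)
    ((integrable_const 1).indicator hm2), integral_indicator_const _ hm1,
    integral_indicator_const _ hm2]
  simp [Measure.real, hξ.prob_one i hi, hξ.prob_neg_one i hi]

theorem integral_succ_mul_eq_zero (hξ : IsFairSignSequence P ξ) {n : ℕ} {W : Ω → ℝ}
    (hW : Measurable[info ξ n] W) : ∫ ω, ξ (n + 1) ω * W ω ∂P = 0 := by
  have hindep : IndepFun (ξ (n + 1)) W P :=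
    (IndepFun_iff_Indep _ _ _).2
      (indep_of_indep_of_le_right (hξ.indep_comap_succ_info n) hW.comap_le)
  rw [hindep.integral_fun_mul_eq_mul_integral
    (hξ.measurable _ (by lia)).aestronglyMeasurable
    (hW.mono (hξ.info_le _) le_rfl).aestronglyMeasurable, hξ.integral_eq_zero (by lia), zero_mul]

theorem setIntegral_transform_succ_sq (hξ : IsFairSignSequence P ξ)
    (hZ : IsBoundedPredictable P ξ Z) {n : ℕ} {s : Set Ω} (hs : MeasurableSet[info ξ n] s) :
    ∫ ω in s, transform ξ Z (n + 1) ω ^ 2 ∂P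
      = ∫ ω in s, transform ξ Z n ω ^ 2 ∂P + ∫ ω in s, Z (n + 1) ω ^ 2 ∂P := by
  have hM := hξ.memLp_top_transform hZ n
  have hZn := hZ.memLp_top (n + 1) (by lia)
  have hMi : Integrable (fun ω => transform ξ Z n ω ^ 2) P :=
    (hM.mono_exponent le_top).integrable_sq
  have hZi : Integrable (fun ω => Z (n + 1) ω ^ 2) P :=
    (hZn.mono_exponent le_top).integrable_sq
  have hMZ : MemLp (fun ω => 2 * (transform ξ Z n ω * Z (n + 1) ω)) ∞ P :=
    MemLp.const_mul (hZn.mul' hM) 2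
  have hcross : Integrable
      (fun ω => ξ (n + 1) ω * (2 * (transform ξ Z n ω * Z (n + 1) ω))) P :=
    memLp_one_iff_integrable.1 ((hMZ.mul' (hξ.memLp_top (by lia)) :
      MemLp _ ∞ P).mono_exponent le_top)
  have hs' : MeasurableSet s := hξ.info_le n s hs
  have hexpand : ∀ᵐ ω ∂P.restrict s, transform ξ Z (n + 1) ω ^ 2 = transform ξ Z n ω ^ 2
      + ξ (n + 1) ω * (2 * (transform ξ Z n ω * Z (n + 1) ω)) + Z (n + 1) ω ^ 2 := by
    refine ae_restrict_of_ae ?_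
    filter_upwards [hξ.ae_abs_eq] with ω hω
    have hsq : ξ (n + 1) ω ^ 2 = 1 := by rw [← sq_abs, hω _ (by lia), one_pow]
    rw [transform_succ]
    linear_combination Z (n + 1) ω ^ 2 * hsq
  have hzero : ∫ ω in s, ξ (n + 1) ω * (2 * (transform ξ Z n ω * Z (n + 1) ω)) ∂P = 0 := by
    rw [← integral_indicator hs']
    simp only [Set.indicator_mul_right s (ξ (n + 1))]
    exact hξ.integral_succ_mul_eq_zero ((measurable_const.mul
      ((hZ.measurable_transform n).mul (hZ.measurable (n + 1) (by lia)))).indicator hs)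
  rw [integral_congr_ae hexpand,
    integral_add (by exact hMi.restrict.add hcross.restrict) hZi.restrict,
    integral_add hMi.restrict hcross.restrict, hzero, add_zero]

theorem integral_transform_sq (hξ : IsFairSignSequence P ξ) (hZ : IsBoundedPredictable P ξ Z)
    (n : ℕ) : ∫ ω, transform ξ Z n ω ^ 2 ∂P = ∑ k ∈ Finset.Icc 1 n, ∫ ω, Z k ω ^ 2 ∂P := by
  induction n with
  | zero => simp [transform]
  | succ n ih =>
    rw [Finset.sum_Icc_succ_top (by lia), ← ih]
    simpa using hξ.setIntegral_transform_succ_sq hZ (n := n) .univ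

theorem integral_sum_sq (hξ : IsFairSignSequence P ξ) (c : ℕ → ℝ) (n : ℕ) :
    ∫ ω, (∑ i ∈ Finset.Icc 1 n, c i * ξ i ω) ^ 2 ∂P = ∑ i ∈ Finset.Icc 1 n, c i ^ 2 := by
  have hc : IsBoundedPredictable P ξ fun k _ => c k :=
    ⟨fun _ _ => measurable_const, fun k _ => memLp_const (c k)⟩
  simpa [transform, mul_comm] using hξ.integral_transform_sq hc n

theorem submartingale_transform_sq (hξ : IsFairSignSequence P ξ)
    (hZ : IsBoundedPredictable P ξ Z) :
    Submartingale (fun n ω => transform ξ Z n ω ^ 2) hξ.filtration P := by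
  refine submartingale_of_setIntegral_le_succ
    (fun n => ((hZ.measurable_transform n).pow_const 2).stronglyMeasurable)
    (fun n => ((hξ.memLp_top_transform hZ n).mono_exponent le_top).integrable_sq)
    fun n s hs => ?_
  rw [hξ.setIntegral_transform_succ_sq hZ hs]
  exact le_add_of_nonneg_right (integral_nonneg fun ω => sq_nonneg _)

theorem measure_exists_transform_lt_le (hξ : IsFairSignSequence P ξ)
    (hZ : IsBoundedPredictable P ξ Z) (N : ℕ) {c : ℝ} (hc : 0 < c) :
    P {ω | ∃ n ∈ Finset.Icc 1 N, transform ξ Z n ω < -c}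
      ≤ ENNReal.ofReal ((∑ k ∈ Finset.Icc 1 N, ∫ ω, Z k ω ^ 2 ∂P) / c ^ 2) := by
  have hc2 : (0 : ℝ) < c ^ 2 := by positivity
  set A : Set Ω := {ω | ((c ^ 2).toNNReal : ℝ) ≤ (Finset.range (N + 1)).sup'
    Finset.nonempty_range_add_one fun n => transform ξ Z n ω ^ 2}
  have hsub : {ω | ∃ n ∈ Finset.Icc 1 N, transform ξ Z n ω < -c} ⊆ A := by
    rintro ω ⟨n, hn, hlt⟩
    have hmem : n ∈ Finset.range (N + 1) :=
      Finset.mem_range.2 (Nat.lt_succ_of_le (Finset.mem_Icc.1 hn).2)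
    refine (Real.coe_toNNReal _ hc2.le).le.trans (le_trans ?_
      (Finset.le_sup' (fun n => transform ξ Z n ω ^ 2) hmem))
    nlinarith
  have hdoob : ENNReal.ofReal (c ^ 2) * P A
      ≤ ENNReal.ofReal (∫ ω in A, transform ξ Z N ω ^ 2 ∂P) :=
    maximal_ineq (hξ.submartingale_transform_sq hZ) (fun _ _ => sq_nonneg _) N
  have hA : ∫ ω in A, transform ξ Z N ω ^ 2 ∂P ≤ ∑ k ∈ Finset.Icc 1 N, ∫ ω, Z k ω ^ 2 ∂P :=
    (setIntegral_le_integral ((hξ.memLp_top_transform hZ N).mono_exponent le_top).integrable_sq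
      (.of_forall fun _ => sq_nonneg _)).trans_eq (hξ.integral_transform_sq hZ N)
  refine (measure_mono hsub).trans ?_
  rw [ENNReal.ofReal_div_of_pos hc2,
    ENNReal.le_div_iff_mul_le (.inl (ENNReal.ofReal_pos.2 hc2).ne') (.inl ENNReal.ofReal_ne_top),
    mul_comm]
  exact hdoob.trans (ENNReal.ofReal_le_ofReal hA)

end IsFairSignSequence

end Signs

/-! ### Quadratic forms in fair signs -/

section Quadratic

variable {Ω : Type*} [MeasurableSpace Ω] {P : Measure Ω} {ξ : ℕ → Ω → ℝ}

theorem sum_sum_Icc_succ {M : Type*} [AddCommGroup M] (f : ℕ → ℕ → M) (n : ℕ) :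
    ∑ i ∈ Finset.Icc 1 (n + 1), ∑ l ∈ Finset.Icc 1 (n + 1), f i l
      = ∑ i ∈ Finset.Icc 1 n, ∑ l ∈ Finset.Icc 1 n, f i l
        + ∑ i ∈ Finset.Icc 1 n, (f i (n + 1) + f (n + 1) i) + f (n + 1) (n + 1) := by
  simp only [Finset.sum_Icc_succ_top (show 1 ≤ n + 1 by lia), Finset.sum_add_distrib]
  abel

theorem sum_sum_add_sq_le (a : ℕ → ℕ → ℝ) (n : ℕ) :
    ∑ k ∈ Finset.Icc 1 n, ∑ i ∈ Finset.Icc 1 (k - 1), (a i k + a k i) ^ 2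
      ≤ 2 * ∑ i ∈ Finset.Icc 1 n, ∑ l ∈ Finset.Icc 1 n, a i l ^ 2 := by
  induction n with
  | zero => simp
  | succ n ih =>
    have hnew : ∑ i ∈ Finset.Icc 1 n, (a i (n + 1) + a (n + 1) i) ^ 2
        ≤ 2 * ∑ i ∈ Finset.Icc 1 n, (a i (n + 1) ^ 2 + a (n + 1) i ^ 2) := by
      rw [Finset.mul_sum]
      exact Finset.sum_le_sum fun _ _ => add_sq_le
    rw [Finset.sum_Icc_succ_top (by lia), sum_sum_Icc_succ, Nat.add_sub_cancel]
    linarith [sq_nonneg (a (n + 1) (n + 1))]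

theorem sum_sum_mul_sq_eq {ι κ : Type*} (t : Finset ι) (I : Finset κ) (u v : ι → κ → ℝ) :
    ∑ i ∈ I, ∑ l ∈ I, (∑ k ∈ t, u k i * v k l) ^ 2
      = ∑ k ∈ t, ∑ k' ∈ t, (∑ i ∈ I, u k i * u k' i) * ∑ l ∈ I, v k l * v k' l := by
  calc ∑ i ∈ I, ∑ l ∈ I, (∑ k ∈ t, u k i * v k l) ^ 2
      = ∑ i ∈ I, ∑ k ∈ t, ∑ l ∈ I, ∑ k' ∈ t, (u k i * v k l) * (u k' i * v k' l) := by
        simp only [sq, Finset.sum_mul_sum]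
        exact Finset.sum_congr rfl fun _ _ => Finset.sum_comm
    _ = ∑ k ∈ t, ∑ i ∈ I, ∑ k' ∈ t, ∑ l ∈ I, (u k i * v k l) * (u k' i * v k' l) := by
        rw [Finset.sum_comm]
        exact Finset.sum_congr rfl fun _ _ => Finset.sum_congr rfl fun _ _ => Finset.sum_comm
    _ = _ := Finset.sum_congr rfl fun k _ => by
        rw [Finset.sum_comm]
        simp only [Finset.sum_mul_sum]
        exact Finset.sum_congr rfl fun _ _ => Finset.sum_congr rfl fun _ _ =>
          Finset.sum_congr rfl fun _ _ => mul_mul_mul_comm ..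

variable [IsProbabilityMeasure P]

theorem IsFairSignSequence.ae_quadratic_sub_eq_transform (hξ : IsFairSignSequence P ξ)
    (a : ℕ → ℕ → ℝ) (n : ℕ) :
    ∀ᵐ ω ∂P, ∑ i ∈ Finset.Icc 1 n, ∑ l ∈ Finset.Icc 1 n, a i l * (ξ i ω * ξ l ω)
        - ∑ i ∈ Finset.Icc 1 n, a i i
      = transform ξ (fun k ω => ∑ i ∈ Finset.Icc 1 (k - 1), (a i k + a k i) * ξ i ω) n ω := by
  filter_upwards [hξ.ae_abs_eq] with ω hω
  induction n with
  | zero => simp [transform]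
  | succ n ih =>
    have hsq : ξ (n + 1) ω ^ 2 = 1 := by rw [← sq_abs, hω _ (by lia), one_pow]
    have hcross : ∑ i ∈ Finset.Icc 1 n, (a i (n + 1) * (ξ i ω * ξ (n + 1) ω)
          + a (n + 1) i * (ξ (n + 1) ω * ξ i ω))
        = ξ (n + 1) ω * ∑ i ∈ Finset.Icc 1 n, (a i (n + 1) + a (n + 1) i) * ξ i ω := by
      rw [Finset.mul_sum]
      exact Finset.sum_congr rfl fun _ _ => by ring
    rw [transform_succ, ← ih, sum_sum_Icc_succ, Finset.sum_Icc_succ_top (by lia), hcross,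
      Nat.add_sub_cancel]
    linear_combination a (n + 1) (n + 1) * hsq

theorem IsFairSignSequence.integral_quadratic_sq_le (hξ : IsFairSignSequence P ξ)
    (a : ℕ → ℕ → ℝ) (n : ℕ) :
    ∫ ω, (∑ i ∈ Finset.Icc 1 n, ∑ l ∈ Finset.Icc 1 n, a i l * (ξ i ω * ξ l ω)
        - ∑ i ∈ Finset.Icc 1 n, a i i) ^ 2 ∂P
      ≤ 2 * ∑ i ∈ Finset.Icc 1 n, ∑ l ∈ Finset.Icc 1 n, a i l ^ 2 := by
  rw [integral_congr_ae ((hξ.ae_quadratic_sub_eq_transform a n).mono fun _ h =>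
      congrArg (· ^ 2) h),
    hξ.integral_transform_sq (hξ.isBoundedPredictable_sum fun k i => a i k + a k i)]
  simp only [hξ.integral_sum_sq]
  exact sum_sum_add_sq_le a n

theorem IsFairSignSequence.integral_sum_mul_sub_sq_le (hξ : IsFairSignSequence P ξ) {ι : Type*}
    (t : Finset ι) (u v : ι → ℕ → ℝ) (n : ℕ) :
    ∫ ω, (∑ k ∈ t, (∑ i ∈ Finset.Icc 1 n, u k i * ξ i ω) * (∑ i ∈ Finset.Icc 1 n, v k i * ξ i ω)
        - ∑ k ∈ t, ∑ i ∈ Finset.Icc 1 n, u k i * v k i) ^ 2 ∂P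
      ≤ 2 * ∑ k ∈ t, ∑ k' ∈ t, (∑ i ∈ Finset.Icc 1 n, u k i * u k' i)
        * ∑ i ∈ Finset.Icc 1 n, v k i * v k' i := by
  have hform : ∀ ω, ∑ k ∈ t, (∑ i ∈ Finset.Icc 1 n, u k i * ξ i ω)
        * (∑ i ∈ Finset.Icc 1 n, v k i * ξ i ω)
      = ∑ i ∈ Finset.Icc 1 n, ∑ l ∈ Finset.Icc 1 n, (∑ k ∈ t, u k i * v k l)
        * (ξ i ω * ξ l ω) := fun ω => by
    simp only [Finset.sum_mul_sum]
    rw [Finset.sum_comm]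
    refine Finset.sum_congr rfl fun _ _ => ?_
    rw [Finset.sum_comm]
    simp only [Finset.sum_mul]
    exact Finset.sum_congr rfl fun _ _ => Finset.sum_congr rfl fun _ _ => mul_mul_mul_comm ..
  rw [← sum_sum_mul_sq_eq, Finset.sum_comm (s := t)]
  simp only [hform]
  exact hξ.integral_quadratic_sq_le _ n

end Quadratic

/-! ### Almost sure convergence -/

section AlmostSure

variable {Ω : Type*} [MeasurableSpace Ω] {P : Measure Ω}

theorem ae_tendsto_zero_of_summable_integral_sq {F : ℕ → Ω → ℝ}
    (hF : ∀ j, Integrable (fun ω => F j ω ^ 2) P) (hs : Summable fun j => ∫ ω, F j ω ^ 2 ∂P) :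
    ∀ᵐ ω ∂P, Tendsto (fun j => F j ω) atTop (𝓝 0) := by
  have hm : ∀ j, AEMeasurable (fun ω => ENNReal.ofReal (F j ω ^ 2)) P := fun j =>
    (hF j).aemeasurable.ennreal_ofReal
  have hlintegral : ∀ j, ∫⁻ ω, ENNReal.ofReal (F j ω ^ 2) ∂P
      = ENNReal.ofReal (∫ ω, F j ω ^ 2 ∂P) := fun j =>
    (ofReal_integral_eq_lintegral_ofReal (hF j) (.of_forall fun _ => sq_nonneg _)).symm
  have hfin : ∫⁻ ω, ∑' j, ENNReal.ofReal (F j ω ^ 2) ∂P ≠ ∞ := by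
    simp only [lintegral_tsum hm, hlintegral]
    exact hs.tsum_ofReal_ne_top
  filter_upwards [ae_lt_top' (AEMeasurable.tsum hm) hfin] with ω hω
  have hsq : Tendsto (fun j => F j ω ^ 2) atTop (𝓝 0) := by
    simpa [Function.comp_def, ENNReal.toReal_ofReal (sq_nonneg _)] using
      (ENNReal.tendsto_toReal ENNReal.zero_ne_top).comp
        (ENNReal.tendsto_atTop_zero_of_tsum_ne_top hω.ne)
  refine (tendsto_zero_iff_abs_tendsto_zero _).2 ?_
  simpa [Function.comp_def, Real.sqrt_sq_eq_abs] using hsq.sqrt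

/-- Borel–Cantelli: the exponent `p` makes the variances along the subsequence summable. -/
theorem ae_tendsto_pow_div_of_integral_sq_le {F : ℕ → Ω → ℝ} {C α : ℝ} {p : ℕ}
    (hF : ∀ n, Integrable (fun ω => F n ω ^ 2) P)
    (hle : ∀ n, 1 ≤ n → ∫ ω, F n ω ^ 2 ∂P ≤ C * (n : ℝ) ^ α) (hp : 1 < p * (2 - α)) :
    ∀ᵐ ω ∂P, Tendsto (fun j : ℕ => F (j ^ p) ω / ((j ^ p : ℕ) : ℝ)) atTop (𝓝 0) := by
  refine ae_tendsto_zero_of_summable_integral_sq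
    (fun j => by simpa only [div_pow] using (hF (j ^ p)).div_const _) ?_
  refine (summable_nat_add_iff 1).1 (.of_nonneg_of_le
    (fun j => integral_nonneg fun ω => sq_nonneg _) (fun j => ?_)
    (((summable_nat_add_iff 1).2 (Real.summable_nat_rpow.2 (neg_lt_neg hp))).mul_left C))
  have hj : (0 : ℝ) < (j + 1 : ℕ) := by positivity
  simp only [div_pow, integral_div]
  rw [div_le_iff₀ (by positivity)]
  refine (hle _ (Nat.one_le_pow _ _ (by lia))).trans_eq ?_
  rw [mul_assoc]
  congr 1
  rw [← Real.rpow_natCast _ 2, Nat.cast_pow, ← Real.rpow_natCast, ← Real.rpow_mul hj.le,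
    ← Real.rpow_mul hj.le, ← Real.rpow_add hj]
  congr 1
  push_cast
  ring

end AlmostSure

/-! ### The moving averages `Y_n` and the sums of `θ^{(1)}`, `θ^{(2)}`, `θ^{(3)}` -/

section MovingAverage

variable {Ω : Type*} {ξ : ℕ → Ω → ℝ} {H σ : ℝ}

/-- The coefficients `j_n(i)`, extended by zero to `i ≥ n`, so that `Y_n` is the linear form
`∑_{i=1}^m jExt n i ξ_i` for every `m ≥ n - 1`. -/
noncomputable def jExt (H σ : ℝ) (n i : ℕ) : ℝ := if i < n then jCoef H σ n i else 0

theorem jExt_of_lt {n i : ℕ} (h : i < n) : jExt H σ n i = jCoef H σ n i := if_pos h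

theorem jExt_nonneg (hH : 1 / 2 ≤ H) (hσ : 0 ≤ σ) {n i : ℕ} (hi : 1 ≤ i) :
    0 ≤ jExt H σ n i := by
  unfold jExt
  split_ifs with h
  · exact jCoef_nonneg hH hσ hi h
  · exact le_rfl

theorem sum_jExt_mul {k n : ℕ} (hkn : k ≤ n + 1) (f : ℕ → ℝ) :
    ∑ i ∈ Finset.Icc 1 n, jExt H σ k i * f i = ∑ i ∈ Finset.Ico 1 k, jCoef H σ k i * f i := by
  have hsub : Finset.Ico 1 k ⊆ Finset.Icc 1 n := fun i hi => by
    rw [Finset.mem_Ico] at hi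
    exact Finset.mem_Icc.2 ⟨hi.1, by lia⟩
  rw [← Finset.sum_subset hsub]
  · exact Finset.sum_congr rfl fun i hi => by rw [jExt_of_lt (Finset.mem_Ico.1 hi).2]
  · intro i hi hi'
    rw [Finset.mem_Ico] at hi'
    rw [jExt, if_neg fun h => hi' ⟨(Finset.mem_Icc.1 hi).1, h⟩, zero_mul]

theorem yProc_eq_sum {k n : ℕ} (hkn : k ≤ n + 1) (ω : Ω) :
    yProc H σ ξ k ω = ∑ i ∈ Finset.Icc 1 n, jExt H σ k i * ξ i ω :=
  (sum_jExt_mul hkn fun i => ξ i ω).symm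

theorem measurable_info_yProc {k n : ℕ} (hkn : k ≤ n + 1) :
    Measurable[info ξ n] (yProc H σ ξ k) := by
  refine Finset.measurable_fun_sum _ fun i hi => ?_
  rw [Finset.mem_Ico] at hi
  exact measurable_const.mul (measurable_info hi.1 (by lia))

theorem gCoef_zero : gCoef H σ 0 = 0 := if_pos rfl

theorem partialSum_theta1_eq_transform (n : ℕ) (ω : Ω) :
    partialSum (theta1 H σ ξ) n ω = transform ξ (fun k ω => ∑ i ∈ Finset.Icc 1 (k - 1),
      (if i = k - 1 then gCoef H σ k * gCoef H σ (k - 1) else 0) * ξ i ω) n ω := by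
  refine Finset.sum_congr rfl fun k _ => ?_
  simp only [theta1, ite_mul, zero_mul, Finset.sum_ite_eq', Finset.mem_Icc, le_refl, and_true]
  split_ifs with h
  · ring
  · rw [show k - 1 = 0 by lia, gCoef_zero]
    ring

theorem partialSum_theta2_eq_transform (n : ℕ) (ω : Ω) :
    partialSum (theta2 H σ ξ) n ω = transform ξ (fun k ω => ∑ i ∈ Finset.Icc 1 (k - 1),
      gCoef H σ k * jExt H σ (k - 1) i * ξ i ω) n ω := by
  refine Finset.sum_congr rfl fun k _ => ?_
  simp only [mul_assoc, ← Finset.mul_sum]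
  rw [theta2, yProc_eq_sum (Nat.le_succ (k - 1))]
  ring

variable [MeasurableSpace Ω] {P : Measure Ω} [IsProbabilityMeasure P]

namespace IsFairSignSequence

theorem memLp_top_yProc (hξ : IsFairSignSequence P ξ) (k : ℕ) : MemLp (yProc H σ ξ k) ∞ P :=
  memLp_finsetSum _ fun _ hi => (hξ.memLp_top (Finset.mem_Ico.1 hi).1).const_mul _

theorem exists_abs_yProc_le (hξ : IsFairSignSequence P ξ) (hH : 1 / 2 < H) (hH1 : H < 1)
    (hσ : 0 ≤ σ) :
    ∃ C : ℝ, 0 ≤ C ∧ ∀ᵐ ω ∂P, ∀ k, |yProc H σ ξ k ω| ≤ C * (k : ℝ) ^ (H - 1 / 2) := by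
  obtain ⟨C, hC, hsum⟩ := exists_sum_jCoef_le hH hH1 hσ
  refine ⟨C, hC, ?_⟩
  filter_upwards [hξ.ae_abs_eq] with ω hω k
  refine (Finset.abs_sum_le_sum_abs _ _).trans (le_trans (le_of_eq ?_) (hsum k))
  refine Finset.sum_congr rfl fun i hi => ?_
  rw [Finset.mem_Ico] at hi
  rw [abs_mul, hω i hi.1, mul_one, abs_of_nonneg (jCoef_nonneg hH.le hσ hi.1 hi.2)]

theorem exists_abs_xProc_le (hξ : IsFairSignSequence P ξ) (hH : 1 / 2 < H) (hH1 : H < 1)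
    (hσ : 0 ≤ σ) :
    ∃ C : ℝ, 0 ≤ C ∧ ∀ᵐ ω ∂P, ∀ k, 1 ≤ k → |xProc H σ ξ k ω| ≤ C * (k : ℝ) ^ (H - 1 / 2) := by
  obtain ⟨C, hC, hY⟩ := hξ.exists_abs_yProc_le hH hH1 hσ
  have hB := coefBound_nonneg hH.le hH1 hσ
  refine ⟨C + coefBound H σ, by positivity, ?_⟩
  filter_upwards [hY, hξ.ae_abs_eq] with ω hω hω' k hk
  have hone : (1 : ℝ) ≤ (k : ℝ) ^ (H - 1 / 2) :=
    Real.one_le_rpow (by exact_mod_cast hk) (by linarith)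
  calc |xProc H σ ξ k ω|
      ≤ |yProc H σ ξ k ω| + gCoef H σ k := by
        rw [← abs_of_nonneg (gCoef_nonneg hH.le hσ k), ← mul_one |gCoef H σ k|, ← hω' k hk,
          ← abs_mul]
        exact abs_add_le _ _
    _ ≤ C * (k : ℝ) ^ (H - 1 / 2) + coefBound H σ * (k : ℝ) ^ (H - 1 / 2) :=
        add_le_add (hω k) ((gCoef_le hH hH1 hσ k).trans (le_mul_of_one_le_right hB hone))
    _ = (C + coefBound H σ) * (k : ℝ) ^ (H - 1 / 2) := by ring

theorem exists_isThetaBound_theta1 (hξ : IsFairSignSequence P ξ) (hH : 1 / 2 < H) (hH1 : H < 1)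
    (hσ : 0 ≤ σ) : ∃ C, IsThetaBound P H (theta1 H σ ξ) C := by
  have hB := coefBound_nonneg hH.le hH1 hσ
  refine ⟨coefBound H σ * coefBound H σ + 1, by positivity, fun N hN n hn => ?_⟩
  filter_upwards [hξ.ae_abs_eq] with ω hω
  have hN1 : (1 : ℝ) ≤ (N : ℝ) ^ (H - 1 / 2) :=
    Real.one_le_rpow (by exact_mod_cast hN) (by linarith)
  have hprod : gCoef H σ (n - 1) * gCoef H σ n ≤ coefBound H σ * coefBound H σ :=
    mul_le_mul (gCoef_le hH hH1 hσ _) (gCoef_le hH hH1 hσ _) (gCoef_nonneg hH.le hσ _) hB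
  refine le_trans ?_ (le_mul_of_one_le_right (by positivity) hN1)
  rcases (n - 1).eq_zero_or_pos with h0 | hpos
  · rw [theta1, h0, gCoef_zero]
    simp only [zero_mul, abs_zero]
    positivity
  · rw [theta1, abs_mul, abs_mul, hω n (Finset.mem_Icc.1 hn).1, hω (n - 1) hpos, mul_one, mul_one,
      abs_of_nonneg (mul_nonneg (gCoef_nonneg hH.le hσ _) (gCoef_nonneg hH.le hσ _))]
    exact hprod.trans (le_add_of_nonneg_right zero_le_one)

theorem exists_isThetaBound_theta2 (hξ : IsFairSignSequence P ξ) (hH : 1 / 2 < H) (hH1 : H < 1)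
    (hσ : 0 ≤ σ) : ∃ C, IsThetaBound P H (theta2 H σ ξ) C := by
  have hB := coefBound_nonneg hH.le hH1 hσ
  obtain ⟨C, hC, hY⟩ := hξ.exists_abs_yProc_le hH hH1 hσ
  refine ⟨coefBound H σ * C + 1, by positivity, fun N hN n hn => ?_⟩
  filter_upwards [hξ.ae_abs_eq, hY] with ω hω hω'
  rw [Finset.mem_Icc] at hn
  have hnN : ((n - 1 : ℕ) : ℝ) ^ (H - 1 / 2) ≤ (N : ℝ) ^ (H - 1 / 2) :=
    Real.rpow_le_rpow (by positivity) (by exact_mod_cast (by lia : n - 1 ≤ N)) (by linarith)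
  calc |theta2 H σ ξ n ω| = gCoef H σ n * |yProc H σ ξ (n - 1) ω| := by
        rw [theta2, abs_mul, abs_mul, hω n hn.1, mul_one, abs_of_nonneg (gCoef_nonneg hH.le hσ n)]
    _ ≤ coefBound H σ * (C * (N : ℝ) ^ (H - 1 / 2)) :=
        mul_le_mul (gCoef_le hH hH1 hσ n)
          ((hω' _).trans (mul_le_mul_of_nonneg_left hnN hC)) (abs_nonneg _) hB
    _ ≤ (coefBound H σ * C + 1) * (N : ℝ) ^ (H - 1 / 2) := by
        rw [add_mul, mul_assoc]
        exact le_add_of_nonneg_right (by positivity)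

theorem measure_exists_linear_transform_lt_le (hξ : IsFairSignSequence P ξ) {a : ℕ → ℕ → ℝ}
    {D : ℝ} (hD : ∀ k, ∑ i ∈ Finset.Icc 1 (k - 1), a k i ^ 2 ≤ D) (N : ℕ) {c : ℝ} (hc : 0 < c) :
    P {ω | ∃ n ∈ Finset.Icc 1 N,
        transform ξ (fun k ω => ∑ i ∈ Finset.Icc 1 (k - 1), a k i * ξ i ω) n ω < -c}
      ≤ ENNReal.ofReal (D * N / c ^ 2) := by
  refine (hξ.measure_exists_transform_lt_le (hξ.isBoundedPredictable_sum a) N hc).trans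
    (ENNReal.ofReal_le_ofReal ?_)
  simp only [hξ.integral_sum_sq]
  gcongr
  simpa [mul_comm] using Finset.sum_le_card_nsmul (Finset.Icc 1 N) _ D fun k _ => hD k

theorem exists_measure_theta1_le (hξ : IsFairSignSequence P ξ) (hH : 1 / 2 < H) (hH1 : H < 1)
    (hσ : 0 ≤ σ) :
    ∃ D : ℝ, ∀ (N : ℕ) (c : ℝ), 0 < c →
      P {ω | ∃ n ∈ Finset.Icc 1 N, partialSum (theta1 H σ ξ) n ω < -c}
        ≤ ENNReal.ofReal (D * N / c ^ 2) := by
  have hB := coefBound_nonneg hH.le hH1 hσ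
  refine ⟨(coefBound H σ * coefBound H σ) ^ 2, fun N c hc => ?_⟩
  simp only [partialSum_theta1_eq_transform]
  refine hξ.measure_exists_linear_transform_lt_le (fun k => ?_) N hc
  simp only [ite_pow, ne_eq, OfNat.ofNat_ne_zero, not_false_eq_true, zero_pow, Finset.sum_ite_eq']
  split_ifs
  · exact pow_le_pow_left₀ (mul_nonneg (gCoef_nonneg hH.le hσ _) (gCoef_nonneg hH.le hσ _))
      (mul_le_mul (gCoef_le hH hH1 hσ _) (gCoef_le hH hH1 hσ _) (gCoef_nonneg hH.le hσ _) hB) 2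
  · positivity

theorem exists_measure_theta2_le (hξ : IsFairSignSequence P ξ) (hH : 1 / 2 < H) (hH1 : H < 1)
    (hσ : 0 ≤ σ) :
    ∃ D : ℝ, ∀ (N : ℕ) (c : ℝ), 0 < c →
      P {ω | ∃ n ∈ Finset.Icc 1 N, partialSum (theta2 H σ ξ) n ω < -c}
        ≤ ENNReal.ofReal (D * N / c ^ 2) := by
  obtain ⟨C, -, hC⟩ := exists_sum_jCoef_sq_le hH hH1 hσ
  refine ⟨coefBound H σ ^ 2 * C, fun N c hc => ?_⟩
  simp only [partialSum_theta2_eq_transform]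
  refine hξ.measure_exists_linear_transform_lt_le (fun k => ?_) N hc
  simp only [mul_pow, ← Finset.mul_sum]
  refine mul_le_mul (pow_le_pow_left₀ (gCoef_nonneg hH.le hσ k) (gCoef_le hH hH1 hσ k) 2) ?_
    (by positivity) (by positivity)
  refine le_of_eq_of_le ?_ (hC (k - 1))
  simp only [sq]
  rw [sum_jExt_mul (Nat.le_succ (k - 1))]
  exact Finset.sum_congr rfl fun i hi => by rw [jExt_of_lt (Finset.mem_Ico.1 hi).2]

/-- `θ^{(3)}_k` contains the nonnegative diagonal term `g_{k-1} j_k(k-1) ξ_{k-1}^2`; without it,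
the sums of `θ^{(3)}`, shifted by one step, are a martingale transform. -/
theorem ae_transform_le_partialSum_theta3 (hξ : IsFairSignSequence P ξ) (hH : 1 / 2 ≤ H)
    (hσ : 0 ≤ σ) :
    ∀ᵐ ω ∂P, ∀ n, transform ξ (fun k ω => ∑ i ∈ Finset.Icc 1 (k - 1),
      gCoef H σ k * jCoef H σ (k + 1) i * ξ i ω) n ω ≤ partialSum (theta3 H σ ξ) (n + 1) ω := by
  filter_upwards [hξ.ae_abs_eq] with ω hω n
  induction n with
  | zero => simp [transform, partialSum, theta3, gCoef_zero]
  | succ n ih =>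
    rw [transform_succ, partialSum, Finset.sum_Icc_succ_top (by lia)]
    refine add_le_add ih ?_
    have hsq : ξ (n + 1) ω ^ 2 = 1 := by rw [← sq_abs, hω _ (by lia), one_pow]
    have hdiag : 0 ≤ gCoef H σ (n + 1) * jCoef H σ (n + 1 + 1) (n + 1) :=
      mul_nonneg (gCoef_nonneg hH hσ _) (jCoef_nonneg hH hσ (by lia) (by lia))
    simp only [theta3, yProc, Nat.add_sub_cancel, mul_assoc, ← Finset.mul_sum]
    rw [Finset.sum_Ico_succ_top (show 1 ≤ n + 1 by lia), ← Finset.Ico_add_one_right_eq_Icc]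
    linear_combination hdiag - gCoef H σ (n + 1) * jCoef H σ (n + 1 + 1) (n + 1) * hsq

theorem exists_measure_theta3_le (hξ : IsFairSignSequence P ξ) (hH : 1 / 2 < H) (hH1 : H < 1)
    (hσ : 0 ≤ σ) :
    ∃ D : ℝ, ∀ (N : ℕ) (c : ℝ), 0 < c →
      P {ω | ∃ n ∈ Finset.Icc 1 N, partialSum (theta3 H σ ξ) n ω < -c}
        ≤ ENNReal.ofReal (D * N / c ^ 2) := by
  obtain ⟨C, -, hC⟩ := exists_sum_jCoef_sq_le hH hH1 hσ
  refine ⟨coefBound H σ ^ 2 * C, fun N c hc => le_trans (measure_mono_ae ?_)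
    (hξ.measure_exists_linear_transform_lt_le
      (a := fun k i => gCoef H σ k * jCoef H σ (k + 1) i) (fun k => ?_) N hc)⟩
  · filter_upwards [hξ.ae_transform_le_partialSum_theta3 hH.le hσ] with ω hω
    rintro ⟨n, hn, hlt⟩
    rw [Finset.mem_Icc] at hn
    obtain ⟨m, rfl⟩ : ∃ m, n = m + 1 := ⟨n - 1, by lia⟩
    rcases m.eq_zero_or_pos with rfl | hm
    · simp only [partialSum, zero_add, Finset.Icc_self, Finset.sum_singleton, theta3, Nat.sub_self,
        gCoef_zero, zero_mul] at hlt
      linarith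
    · exact ⟨m, Finset.mem_Icc.2 ⟨hm, by lia⟩, (hω m).trans_lt hlt⟩
  · simp only [mul_pow, ← Finset.mul_sum]
    refine mul_le_mul (pow_le_pow_left₀ (gCoef_nonneg hH.le hσ k) (gCoef_le hH hH1 hσ k) 2) ?_
      (by positivity) (by positivity)
    refine (Finset.sum_le_sum_of_subset_of_nonneg (fun i hi => ?_)
      fun _ _ _ => sq_nonneg _).trans (hC (k + 1))
    rw [Finset.mem_Icc] at hi
    exact Finset.mem_Ico.2 ⟨hi.1, by lia⟩

end IsFairSignSequence

end MovingAverage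

/-! ### Covariances of the moving averages -/

section Covariance

variable {H σ : ℝ}

/-- The covariance of `Y_k` and `Y_l`. -/
noncomputable def covY (H σ : ℝ) (k l : ℕ) : ℝ :=
  ∑ i ∈ Finset.Ico 1 k, jCoef H σ k i * jExt H σ l i

theorem covY_eq_sum {k l n : ℕ} (hk : k ≤ n + 1) :
    covY H σ k l = ∑ i ∈ Finset.Icc 1 n, jExt H σ k i * jExt H σ l i :=
  (sum_jExt_mul hk _).symm

theorem covY_of_le {k l : ℕ} (hkl : k ≤ l) :
    covY H σ k l = ∑ i ∈ Finset.Ico 1 k, jCoef H σ k i * jCoef H σ l i :=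
  Finset.sum_congr rfl fun i hi => by
    rw [jExt_of_lt ((Finset.mem_Ico.1 hi).2.trans_le hkl)]

theorem covY_comm (k l : ℕ) : covY H σ k l = covY H σ l k := by
  rw [covY_eq_sum (n := max k l) (by lia), covY_eq_sum (k := l) (n := max k l) (by lia)]
  exact Finset.sum_congr rfl fun i _ => mul_comm _ _

theorem jCoef_mul_jExt_nonneg (hH : 1 / 2 ≤ H) (hσ : 0 ≤ σ) {k l i : ℕ}
    (hi : i ∈ Finset.Ico 1 k) : 0 ≤ jCoef H σ k i * jExt H σ l i := by
  rw [Finset.mem_Ico] at hi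
  exact mul_nonneg (jCoef_nonneg hH hσ hi.1 hi.2) (jExt_nonneg hH hσ hi.1)

theorem covY_nonneg (hH : 1 / 2 ≤ H) (hσ : 0 ≤ σ) (k l : ℕ) : 0 ≤ covY H σ k l :=
  Finset.sum_nonneg fun _ hi => jCoef_mul_jExt_nonneg hH hσ hi

theorem exists_covY_self_le (hH : 1 / 2 < H) (hH1 : H < 1) (hσ : 0 ≤ σ) :
    ∃ C : ℝ, ∀ k, covY H σ k k ≤ C := by
  obtain ⟨C, -, hC⟩ := exists_sum_jCoef_sq_le hH hH1 hσ
  exact ⟨C, fun k => by simpa only [covY_of_le le_rfl, ← sq] using hC k⟩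

theorem exists_le_covY_pred (hH : 1 / 2 < H) (hH1 : H < 1) (hσ : 0 < σ) :
    ∃ c : ℝ, 0 < c ∧ ∀ k, 5 ≤ k → c ≤ covY H σ (k - 1) k := by
  have hκ := kernelConst_pos hH hH1
  refine ⟨(σ * kernelConst H * 3 ^ (H - 3 / 2)) * (σ * kernelConst H * 4 ^ (H - 3 / 2)),
    by positivity, fun k hk => ?_⟩
  obtain ⟨i, rfl⟩ : ∃ i, k = i + 3 := ⟨k - 3, by lia⟩
  have hj₁ : σ * kernelConst H * 3 ^ (H - 3 / 2) ≤ jCoef H σ (i + 2) i := by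
    convert le_jCoef hH.le hH1 hσ.le (show 2 ≤ i by lia) (le_refl (i + 2)) using 3
    push_cast
    ring
  have hj₂ : σ * kernelConst H * 4 ^ (H - 3 / 2) ≤ jCoef H σ (i + 3) i := by
    convert le_jCoef hH.le hH1 hσ.le (show 2 ≤ i by lia) (Nat.le_succ (i + 2)) using 3
    push_cast
    ring
  refine le_trans ?_ (Finset.single_le_sum
    (f := fun i' => jCoef H σ (i + 2) i' * jExt H σ (i + 3) i')
    (fun _ hi => jCoef_mul_jExt_nonneg hH.le hσ.le hi)
    (Finset.mem_Ico.2 (by lia) : i ∈ Finset.Ico 1 (i + 2)))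
  rw [jExt_of_lt (show i < i + 3 by lia)]
  exact mul_le_mul hj₁ hj₂ (by positivity) (le_trans (by positivity) hj₁)

theorem exists_covY_le (hH : 1 / 2 < H) (hH1 : H < 1) (hσ : 0 ≤ σ) :
    ∃ C : ℝ, 0 ≤ C ∧ ∀ k l n : ℕ, k ≤ n → l ≤ n →
      covY H σ k l ≤ C * (n : ℝ) ^ (H - 1 / 2) * (|(k : ℝ) - l| + 1) ^ (H - 3 / 2) := by
  obtain ⟨C, hC0, hC⟩ := exists_sum_jCoef_mul_jCoef_le hH hH1 hσ
  refine ⟨C, hC0, fun k l n hk hl => ?_⟩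
  wlog hkl : k ≤ l generalizing k l
  · rw [covY_comm, abs_sub_comm]
    exact this l k hl hk (le_of_not_ge hkl)
  have hlag : |(k : ℝ) - l| + 1 = ((l - k + 1 : ℕ) : ℝ) := by
    rw [abs_sub_comm, abs_of_nonneg (sub_nonneg.2 (by exact_mod_cast hkl))]
    push_cast [Nat.cast_sub hkl]
    rfl
  rw [covY_of_le hkl, hlag]
  refine (hC k l hkl).trans ?_
  have hln : (l : ℝ) ^ (H - 1 / 2) ≤ (n : ℝ) ^ (H - 1 / 2) :=
    Real.rpow_le_rpow (by positivity) (by exact_mod_cast hl) (by linarith)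
  gcongr

theorem summable_abs_int_add_one_rpow {r : ℝ} (hr : r < -1) :
    Summable fun m : ℤ => (|(m : ℝ)| + 1) ^ r := by
  have hnat : Summable fun m : ℕ => ((m : ℝ) + 1) ^ r := by
    simpa using (summable_nat_add_iff 1).2 (Real.summable_nat_rpow.2 hr)
  exact .of_nat_of_neg (by simpa using hnat) (by simpa using hnat)

theorem sum_abs_sub_add_one_rpow_le {r : ℝ} (hr : r < -1) (k : ℕ) (s : Finset ℕ) :
    ∑ l ∈ s, (|(k : ℝ) - l| + 1) ^ r ≤ ∑' m : ℤ, (|(m : ℝ)| + 1) ^ r := by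
  have hinj : Function.Injective fun l : ℕ => (k : ℤ) - l := fun x y hxy => by
    simpa using hxy
  have hsum : ∑ l ∈ s, (|(k : ℝ) - l| + 1) ^ r
      = ∑ m ∈ s.image fun l : ℕ => (k : ℤ) - l, (|(m : ℝ)| + 1) ^ r := by
    rw [Finset.sum_image hinj.injOn]
    simp only [Int.cast_sub, Int.cast_natCast]
  rw [hsum]
  exact (summable_abs_int_add_one_rpow hr).sum_le_tsum _ fun _ _ => by positivity

theorem exists_sum_covY_mul_covY_le (hH : 1 / 2 < H) (hH1 : H < 1) (hσ : 0 ≤ σ) :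
    ∃ C : ℝ, ∀ s t n : ℕ, s ≤ 1 → t ≤ 1 →
      ∑ k ∈ Finset.Icc 1 n, ∑ l ∈ Finset.Icc 1 n,
        covY H σ (k - s) (l - s) * covY H σ (k - t) (l - t) ≤ C * (n : ℝ) ^ (2 * H) := by
  obtain ⟨C, hC0, hC⟩ := exists_covY_le hH hH1 hσ
  set Z := ∑' m : ℤ, (|(m : ℝ)| + 1) ^ (2 * H - 3)
  have hshift : ∀ s k l n : ℕ, s ≤ 1 → k ∈ Finset.Icc 1 n → l ∈ Finset.Icc 1 n →
      covY H σ (k - s) (l - s)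
        ≤ C * (n : ℝ) ^ (H - 1 / 2) * (|(k : ℝ) - l| + 1) ^ (H - 3 / 2) := by
    intro s k l n hs hk hl
    rw [Finset.mem_Icc] at hk hl
    have h := hC (k - s) (l - s) n (by lia) (by lia)
    rwa [Nat.cast_sub (by lia), Nat.cast_sub (by lia), sub_sub_sub_cancel_right] at h
  refine ⟨C ^ 2 * Z, fun s t n hs ht => ?_⟩
  calc ∑ k ∈ Finset.Icc 1 n, ∑ l ∈ Finset.Icc 1 n,
        covY H σ (k - s) (l - s) * covY H σ (k - t) (l - t)
      ≤ ∑ k ∈ Finset.Icc 1 n, ∑ l ∈ Finset.Icc 1 n,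
          (C * (n : ℝ) ^ (H - 1 / 2) * (|(k : ℝ) - l| + 1) ^ (H - 3 / 2)) ^ 2 := by
        refine Finset.sum_le_sum fun k hk => Finset.sum_le_sum fun l hl => ?_
        rw [sq]
        exact mul_le_mul (hshift s k l n hs hk hl) (hshift t k l n ht hk hl)
          (covY_nonneg hH.le hσ _ _) (by positivity)
    _ = ∑ k ∈ Finset.Icc 1 n, (C * (n : ℝ) ^ (H - 1 / 2)) ^ 2
          * ∑ l ∈ Finset.Icc 1 n, (|(k : ℝ) - l| + 1) ^ (2 * H - 3) := by
        simp only [Finset.mul_sum]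
        refine Finset.sum_congr rfl fun k _ => Finset.sum_congr rfl fun l _ => ?_
        rw [mul_pow, ← Real.rpow_mul_natCast (by positivity : 0 ≤ |(k : ℝ) - l| + 1)]
        congr 2
        push_cast
        ring
    _ ≤ ∑ k ∈ Finset.Icc 1 n, (C * (n : ℝ) ^ (H - 1 / 2)) ^ 2 * Z := by
        gcongr with k
        exact sum_abs_sub_add_one_rpow_le (by linarith) k _
    _ = C ^ 2 * Z * (n : ℝ) ^ (2 * H) := by
        rcases n.eq_zero_or_pos with rfl | hn
        · simp [Real.zero_rpow (by linarith : (2 * H) ≠ 0)]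
        have hn' : (n : ℝ) ≠ 0 := by positivity
        rw [Finset.sum_const, Nat.card_Icc, Nat.add_sub_cancel, nsmul_eq_mul, mul_pow,
          ← Real.rpow_mul_natCast n.cast_nonneg,
          show 2 * H = (H - 1 / 2) * (2 : ℕ) + 1 by push_cast; ring, Real.rpow_add_one hn']
        ring

end Covariance

/-! ### Interpolation from a subsequence -/

section Interpolation

theorem eventually_of_eventually_forall_mem_Icc {N : ℕ → ℕ} (hN : Tendsto N atTop atTop)
    {q : ℕ → Prop} (hq : ∀ᶠ j in atTop, ∀ n ∈ Finset.Icc (N j) (N (j + 1)), q n) :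
    ∀ᶠ n in atTop, q n := by
  obtain ⟨J, hJ⟩ := eventually_atTop.1 hq
  filter_upwards [eventually_ge_atTop (N J)] with n hn
  have hex : ∃ i, n < N (i + (J + 1)) :=
    (hN.comp (tendsto_add_atTop_nat (J + 1))).eventually_gt_atTop n |>.exists
  refine hJ (Nat.find hex + J) (Nat.le_add_left _ _) n
    (Finset.mem_Icc.2 ⟨?_, (Nat.find_spec hex).le⟩)
  rcases hi : Nat.find hex with _ | i
  · rwa [zero_add]
  · rw [Nat.add_right_comm]
    exact not_lt.1 (Nat.find_min hex (hi ▸ i.lt_succ_self))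

variable {N : ℕ → ℕ} {c c' C : ℝ} {f g m : ℕ → ℝ}

theorem tendsto_succ_pow_div_pow (p : ℕ) :
    Tendsto (fun j : ℕ => (((j + 1) ^ p : ℕ) : ℝ) / ((j ^ p : ℕ) : ℝ)) atTop (𝓝 1) := by
  have hlim : Tendsto (fun j : ℕ => (1 + 1 / (j : ℝ)) ^ p) atTop (𝓝 1) := by
    simpa only [add_zero, one_pow] using
      ((tendsto_one_div_atTop_nhds_zero_nat (𝕜 := ℝ)).const_add 1).pow p
  refine hlim.congr' ?_
  filter_upwards [eventually_gt_atTop 0] with j hj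
  rw [Nat.cast_pow, Nat.cast_pow, ← div_pow, Nat.cast_succ, add_div,
    div_self (Nat.cast_ne_zero.2 hj.ne')]

theorem tendsto_gap_div (hN : Tendsto N atTop atTop) (hNm : Monotone N)
    (hratio : Tendsto (fun j => (N (j + 1) : ℝ) / N j) atTop (𝓝 1)) (hg : Monotone g)
    (hgm : Tendsto (fun j => (g (N j) - m (N j)) / N j) atTop (𝓝 0))
    (hm : ∀ a b : ℕ, a ≤ b → m b - m a ≤ C * (b - a)) :
    Tendsto (fun j => (g (N (j + 1)) - g (N j)) / N j) atTop (𝓝 0) := by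
  have hub : Tendsto (fun j => (g (N (j + 1)) - m (N (j + 1))) / N (j + 1) * ((N (j + 1) : ℝ) / N j)
      - (g (N j) - m (N j)) / N j + C * ((N (j + 1) : ℝ) / N j - 1)) atTop (𝓝 0) := by
    simpa using (((hgm.comp (tendsto_add_atTop_nat 1)).mul hratio).sub hgm).add
      ((hratio.sub_const 1).const_mul C)
  refine tendsto_of_tendsto_of_tendsto_of_le_of_le' tendsto_const_nhds hub
    (.of_forall fun j => div_nonneg (sub_nonneg.2 (hg (hNm j.le_succ))) (Nat.cast_nonneg _)) ?_
  filter_upwards [hN.eventually_gt_atTop 0] with j hj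
  have hj1 : (N (j + 1) : ℝ) ≠ 0 := by exact_mod_cast (hj.trans_le (hNm j.le_succ)).ne'
  calc (g (N (j + 1)) - g (N j)) / N j
      ≤ (g (N (j + 1)) - m (N (j + 1)) - (g (N j) - m (N j)) + C * (N (j + 1) - N j)) / N j := by
        gcongr
        linarith [hm _ _ (hNm j.le_succ)]
    _ = _ := by field_simp

theorem eventually_mul_le_of_tendsto (hN : Tendsto N atTop atTop)
    (hfm : Tendsto (fun j => (f (N j) - m (N j)) / N j) atTop (𝓝 0))
    (hm : ∀ n : ℕ, c * n - C ≤ m n) (hc : c' < c) : ∀ᶠ j in atTop, c' * N j ≤ f (N j) := by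
  have hlim : Tendsto (fun j => (f (N j) - m (N j)) / N j - C / N j) atTop (𝓝 0) := by
    simpa only [sub_zero] using hfm.sub
      (Tendsto.const_div_atTop (g := fun j => (N j : ℝ)) (tendsto_natCast_atTop_atTop.comp hN) C)
  filter_upwards [hlim.eventually_const_le (sub_neg.2 hc), hN.eventually_gt_atTop 0] with j hj hj0
  have hj' : (0 : ℝ) < N j := by exact_mod_cast hj0
  rw [← sub_div, le_div_iff₀ hj'] at hj
  linarith [hm (N j)]

/-- If `f` is not monotone but decreases at most as fast as the monotone `g` increases, then
between two terms of the subsequence it drops by at most the increment of `g`. -/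
theorem eventually_mul_le_of_subsequence (hN : Tendsto N atTop atTop)
    (hratio : Tendsto (fun j => (N (j + 1) : ℝ) / N j) atTop (𝓝 1))
    (hfg : Monotone fun n => f n + g n) (hg : Monotone g)
    (hgap : Tendsto (fun j => (g (N (j + 1)) - g (N j)) / N j) atTop (𝓝 0))
    (hf : ∀ᶠ j in atTop, c * N j ≤ f (N j)) (hc0 : 0 ≤ c') (hc : c' < c) :
    ∀ᶠ n : ℕ in atTop, c' * n ≤ f n := by
  refine eventually_of_eventually_forall_mem_Icc hN ?_
  have hlim : Tendsto (fun j => c' * ((N (j + 1) : ℝ) / N j)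
      + (g (N (j + 1)) - g (N j)) / N j) atTop (𝓝 c') := by
    simpa only [mul_one, add_zero] using (hratio.const_mul c').add hgap
  filter_upwards [hf, hlim.eventually_le_const hc, hN.eventually_gt_atTop 0] with j hfj hj hj0 n hn
  rw [Finset.mem_Icc] at hn
  have hj' : (0 : ℝ) < N j := by exact_mod_cast hj0
  rw [← mul_div_assoc, ← add_div, div_le_iff₀ hj'] at hj
  calc c' * n ≤ c' * N (j + 1) := by gcongr; exact hn.2
    _ ≤ c * N j - (g (N (j + 1)) - g (N j)) := by linarith
    _ ≤ f n := by linarith [hfg hn.1, hg hn.2]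

end Interpolation

/-! ### The law of large numbers for `θ^{(4)}` -/

section LagSums

variable {Ω : Type*} {ξ : ℕ → Ω → ℝ} {H σ : ℝ}

/-- The sum `∑_{k=1}^n Y_{k-s} Y_{k-t}`; for `s = 1`, `t = 0` it is the sum of the `θ^{(4)}`. -/
noncomputable def lagSum (H σ : ℝ) (ξ : ℕ → Ω → ℝ) (s t n : ℕ) (ω : Ω) : ℝ :=
  ∑ k ∈ Finset.Icc 1 n, yProc H σ ξ (k - s) ω * yProc H σ ξ (k - t) ω

/-- The expectation of `lagSum H σ ξ s t n`. -/
noncomputable def lagMean (H σ : ℝ) (s t n : ℕ) : ℝ :=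
  ∑ k ∈ Finset.Icc 1 n, covY H σ (k - s) (k - t)

theorem monotone_lagSum_self (s : ℕ) (ω : Ω) : Monotone fun n => lagSum H σ ξ s s n ω :=
  fun _ _ h => Finset.sum_le_sum_of_subset_of_nonneg (Finset.Icc_subset_Icc_right h)
    fun _ _ _ => mul_self_nonneg _

theorem monotone_lagSum_add (ω : Ω) : Monotone fun n =>
    lagSum H σ ξ 1 0 n ω + (lagSum H σ ξ 1 1 n ω + lagSum H σ ξ 0 0 n ω) / 2 :=
  monotone_nat_of_le_succ fun n => by
    simp only [lagSum, Finset.sum_Icc_succ_top (Nat.le_add_left 1 n)]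
    linarith [sq_nonneg (yProc H σ ξ (n + 1 - 1) ω + yProc H σ ξ (n + 1 - 0) ω),
      add_sq' (yProc H σ ξ (n + 1 - 1) ω) (yProc H σ ξ (n + 1 - 0) ω)]

theorem exists_lagMean_self_sub_le (hH : 1 / 2 < H) (hH1 : H < 1) (hσ : 0 ≤ σ) :
    ∃ C : ℝ, ∀ s a b : ℕ, a ≤ b → lagMean H σ s s b - lagMean H σ s s a ≤ C * (b - a) := by
  obtain ⟨C, hC⟩ := exists_covY_self_le hH hH1 hσ
  refine ⟨C, fun s a b hab => ?_⟩
  induction b, hab using Nat.le_induction with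
  | base => simp
  | succ b _ ih =>
    rw [lagMean, Finset.sum_Icc_succ_top (Nat.le_add_left 1 b), ← lagMean]
    push_cast
    linarith [hC (b + 1 - s)]

theorem exists_le_lagMean (hH : 1 / 2 < H) (hH1 : H < 1) (hσ : 0 < σ) :
    ∃ c C : ℝ, 0 < c ∧ ∀ n : ℕ, c * n - C ≤ lagMean H σ 1 0 n := by
  obtain ⟨c, hc0, hc⟩ := exists_le_covY_pred hH hH1 hσ
  refine ⟨c, c * 4, hc0, fun n => ?_⟩
  induction n with
  | zero => simp [lagMean, hc0.le]
  | succ n ih =>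
    rw [lagMean, Finset.sum_Icc_succ_top (Nat.le_add_left 1 n), ← lagMean]
    by_cases hn : 5 ≤ n + 1
    · have := hc (n + 1) hn
      rw [Nat.add_sub_cancel, Nat.sub_zero]
      rw [Nat.add_sub_cancel] at this
      push_cast
      linarith
    · have hn4 : ((n + 1 : ℕ) : ℝ) ≤ 4 := by exact_mod_cast (by lia : n + 1 ≤ 4)
      have hnonneg : ∀ k l, 0 ≤ covY H σ k l := covY_nonneg hH.le hσ.le
      calc c * ((n + 1 : ℕ) : ℝ) - c * 4 ≤ 0 := sub_nonpos.2 (by gcongr)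
        _ ≤ _ := add_nonneg (Finset.sum_nonneg fun _ _ => hnonneg _ _) (hnonneg _ _)

variable [MeasurableSpace Ω] {P : Measure Ω} [IsProbabilityMeasure P]

namespace IsFairSignSequence

theorem memLp_top_lagSum (hξ : IsFairSignSequence P ξ) (s t n : ℕ) :
    MemLp (lagSum H σ ξ s t n) ∞ P :=
  memLp_finsetSum _ fun _ _ => (hξ.memLp_top_yProc _).mul (hξ.memLp_top_yProc _)

theorem exists_integral_lagSum_sub_sq_le (hξ : IsFairSignSequence P ξ) (hH : 1 / 2 < H)
    (hH1 : H < 1) (hσ : 0 ≤ σ) : ∃ C : ℝ, ∀ s t n : ℕ, s ≤ 1 → t ≤ 1 →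
      ∫ ω, (lagSum H σ ξ s t n ω - lagMean H σ s t n) ^ 2 ∂P ≤ C * (n : ℝ) ^ (2 * H) := by
  obtain ⟨C, hC⟩ := exists_sum_covY_mul_covY_le hH hH1 hσ
  refine ⟨2 * C, fun s t n hs ht => ?_⟩
  have hle : ∀ s, ∀ k ∈ Finset.Icc 1 n, k - s ≤ n + 1 := fun s k hk => by
    have := (Finset.mem_Icc.1 hk).2
    lia
  have hsum : ∀ ω, lagSum H σ ξ s t n ω = ∑ k ∈ Finset.Icc 1 n,
      (∑ i ∈ Finset.Icc 1 n, jExt H σ (k - s) i * ξ i ω)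
        * ∑ i ∈ Finset.Icc 1 n, jExt H σ (k - t) i * ξ i ω := fun ω =>
    Finset.sum_congr rfl fun k hk => by
      rw [yProc_eq_sum (hle s k hk), yProc_eq_sum (hle t k hk)]
  have hmean : lagMean H σ s t n = ∑ k ∈ Finset.Icc 1 n,
      ∑ i ∈ Finset.Icc 1 n, jExt H σ (k - s) i * jExt H σ (k - t) i :=
    Finset.sum_congr rfl fun k hk => covY_eq_sum (hle s k hk)
  simp only [hsum, hmean, mul_assoc 2 C]
  refine (hξ.integral_sum_mul_sub_sq_le _ _ _ n).trans (mul_le_mul_of_nonneg_left ?_ zero_le_two)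
  refine le_of_eq_of_le (Finset.sum_congr rfl fun k hk => Finset.sum_congr rfl fun l _ => ?_)
    (hC s t n hs ht)
  rw [covY_eq_sum (hle s k hk), covY_eq_sum (hle t k hk)]

theorem exists_ae_tendsto_lagSum (hξ : IsFairSignSequence P ξ) (hH : 1 / 2 < H) (hH1 : H < 1)
    (hσ : 0 ≤ σ) : ∃ N : ℕ → ℕ, Monotone N ∧ Tendsto N atTop atTop ∧
      Tendsto (fun j => (N (j + 1) : ℝ) / N j) atTop (𝓝 1) ∧ ∀ s t : ℕ, s ≤ 1 → t ≤ 1 →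
        ∀ᵐ ω ∂P, Tendsto (fun j => (lagSum H σ ξ s t (N j) ω - lagMean H σ s t (N j)) / N j)
          atTop (𝓝 0) := by
  obtain ⟨C, hC⟩ := hξ.exists_integral_lagSum_sub_sq_le hH hH1 hσ
  obtain ⟨p, hp⟩ := exists_nat_gt (1 / (2 - 2 * H))
  have hp1 : 1 < p * (2 - 2 * H) := (div_lt_iff₀ (by linarith)).1 hp
  have hp0 : p ≠ 0 := fun h => by
    rw [h, Nat.cast_zero, zero_mul] at hp1
    exact absurd hp1 (by norm_num)
  refine ⟨fun j => j ^ p, fun _ _ h => Nat.pow_le_pow_left h p, tendsto_pow_atTop hp0,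
    tendsto_succ_pow_div_pow p, fun s t hs ht => ae_tendsto_pow_div_of_integral_sq_le
    (F := fun n ω => lagSum H σ ξ s t n ω - lagMean H σ s t n) (fun n => ?_)
    (fun n _ => hC s t n hs ht) hp1⟩
  exact (((hξ.memLp_top_lagSum s t n).sub (memLp_const _)).mono_exponent le_top).integrable_sq

theorem exists_ae_le_partialSum_theta4 (hξ : IsFairSignSequence P ξ) (hH : 1 / 2 < H)
    (hH1 : H < 1) (hσ : 0 < σ) : ∃ c : ℝ, 0 < c ∧
      ∀ᵐ ω ∂P, ∀ᶠ n : ℕ in atTop, c * n ≤ partialSum (theta4 H σ ξ) n ω := by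
  obtain ⟨N, hNm, hN, hratio, hlim⟩ := hξ.exists_ae_tendsto_lagSum hH hH1 hσ.le
  obtain ⟨C, hC⟩ := exists_lagMean_self_sub_le hH hH1 hσ.le
  obtain ⟨c, K, hc0, hc⟩ := exists_le_lagMean hH hH1 hσ
  refine ⟨c / 3, by positivity, ?_⟩
  filter_upwards [hlim 1 0 le_rfl zero_le_one, hlim 1 1 le_rfl le_rfl,
    hlim 0 0 zero_le_one zero_le_one] with ω h10 h11 h00
  let g : ℕ → ℝ := fun n => (lagSum H σ ξ 1 1 n ω + lagSum H σ ξ 0 0 n ω) / 2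
  let m : ℕ → ℝ := fun n => (lagMean H σ 1 1 n + lagMean H σ 0 0 n) / 2
  have hg : Monotone g := fun a b h => div_le_div_of_nonneg_right
    (add_le_add (monotone_lagSum_self 1 ω h) (monotone_lagSum_self 0 ω h)) zero_le_two
  have hgm : Tendsto (fun j => (g (N j) - m (N j)) / N j) atTop (𝓝 0) := by
    have hhalf := (h11.add h00).div_const 2
    rw [add_zero, zero_div] at hhalf
    refine hhalf.congr fun j => ?_
    simp only [g, m]
    ring
  have hm : ∀ a b : ℕ, a ≤ b → m b - m a ≤ C * (b - a) := fun a b hab => by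
    simp only [m]
    linarith [hC 1 a b hab, hC 0 a b hab]
  have hsub : ∀ᶠ j in atTop, c / 2 * N j ≤ lagSum H σ ξ 1 0 (N j) ω :=
    eventually_mul_le_of_tendsto (f := fun n => lagSum H σ ξ 1 0 n ω) hN h10 hc (half_lt_self hc0)
  exact eventually_mul_le_of_subsequence (f := fun n => lagSum H σ ξ 1 0 n ω) (g := g) hN hratio
    (monotone_lagSum_add ω) hg (tendsto_gap_div hN hNm hratio hg hgm hm) hsub
    (by positivity) (by linarith)

end IsFairSignSequence

end LagSums

/-! ### Frictionless trading -/

section Trading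

variable {Ω : Type*}

theorem liquidationValue_ofStock (S φ : ℕ → Ω → ℝ) (n : ℕ) (ω : Ω) :
    liquidationValue S 0 (ofStock S 0 φ) n ω
      = ∑ k ∈ Finset.range n, φ k ω * (S (k + 1) ω - S k ω) := by
  have hpos : ∀ x : ℝ, x⁺ = x + x⁻ := fun x => sub_eq_iff_eq_add.1 (posPart_sub_negPart x)
  induction n with
  | zero =>
    simp only [liquidationValue, ofStock, increment, zero_add, Finset.sum_range_one,
      Finset.range_zero, Finset.sum_empty, sub_zero, hpos]
    ring
  | succ n ih =>
    rw [Finset.sum_range_succ, ← ih]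
    simp only [liquidationValue, ofStock, Finset.sum_range_succ _ (n + 1), increment, sub_zero,
      hpos]
    ring

theorem measurable_info_increment {ξ φ : ℕ → Ω → ℝ} (hφ : ∀ n, Measurable[info ξ n] (φ n))
    (k : ℕ) : Measurable[info ξ k] (increment 0 φ k) := by
  rcases k with _ | k
  · exact (hφ 0).sub measurable_const
  · exact (hφ (k + 1)).sub ((hφ k).mono (info_mono k.le_succ) le_rfl)

theorem isSelfFinancing_ofStock {ξ S φ : ℕ → Ω → ℝ} {N : ℕ}
    (hS : ∀ n, Measurable[info ξ n] (S n)) (hφ : ∀ n, Measurable[info ξ n] (φ n)) :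
    IsSelfFinancing ξ S 0 N (ofStock S 0 φ) where
  adapted_bond n _ := by
    have hle : ∀ k ∈ Finset.range (n + 1), info ξ k ≤ info ξ n := fun k hk =>
      info_mono (Nat.lt_succ_iff.1 (Finset.mem_range.1 hk))
    have hinc := measurable_info_increment hφ
    refine (measurable_const.sub (Finset.measurable_fun_sum _ fun k hk => ?_)).add
      (measurable_const.mul (Finset.measurable_fun_sum _ fun k hk => ?_))
    · exact (((hinc k).max measurable_const).mul (hS k)).mono (hle k hk) le_rfl
    · exact (((hinc k).neg.max measurable_const).mul (hS k)).mono (hle k hk) le_rfl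
  adapted_stock n _ := hφ n
  financing n _ ω := by
    rcases n with _ | n
    · simp [ofStock, increment]
    · refine le_of_eq ?_
      change (ofStock S 0 φ).bond (n + 1) ω - (ofStock S 0 φ).bond n ω = _
      simp only [ofStock, Finset.sum_range_succ _ (n + 1)]
      ring

end Trading

/-! ### The stopping time and the strategy `ψ^N` -/

section Stopping

variable {Ω : Type*} {ξ θ : ℕ → Ω → ℝ} {H σ s₀ ε : ℝ} {N k : ℕ} {ω : Ω}

theorem lt_dropTime_iff : (k : ℕ∞) < dropTime θ N ε ω ↔
    ∀ m ∈ Finset.Icc 1 N, m ≤ k → -ε ≤ 1 / (N : ℝ) * partialSum θ m ω := by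
  rw [← ENat.add_one_le_iff (ENat.natCast_ne_top k), dropTime]
  simp only [le_iInf_iff, and_imp]
  refine forall₂_congr fun m _ => ?_
  rw [← not_lt, imp_not_comm, not_lt, ← Nat.cast_add_one, Nat.cast_lt, Nat.lt_succ_iff]

theorem dropTime_eq_top_iff : dropTime θ N ε ω = ⊤ ↔ (N : ℕ∞) < dropTime θ N ε ω := by
  refine ⟨fun h => h ▸ ENat.natCast_lt_top N, fun h => ?_⟩
  rw [lt_dropTime_iff] at h
  simp only [dropTime, iInf_eq_top]
  exact fun m hm => absurd (h m hm.1 (Finset.mem_Icc.1 hm.1).2) (not_le.2 hm.2)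

theorem dropTime_eq_top_iff_forall (hN : 1 ≤ N) : dropTime θ N ε ω = ⊤ ↔
    ∀ m ∈ Finset.Icc 1 N, -(ε * N) ≤ partialSum θ m ω := by
  have hN' : (0 : ℝ) < N := by exact_mod_cast hN
  rw [dropTime_eq_top_iff, lt_dropTime_iff]
  refine forall₂_congr fun m hm => ?_
  rw [imp_iff_right (Finset.mem_Icc.1 hm).2, one_div_mul_eq_div, le_div_iff₀ hN', neg_mul]

theorem neg_le_of_lt_dropTime (hε : 0 ≤ ε) (hkN : k ≤ N)
    (h : (k : ℕ∞) < dropTime θ N ε ω) : -ε ≤ 1 / (N : ℝ) * partialSum θ k ω := by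
  rcases k.eq_zero_or_pos with rfl | hk
  · simp [partialSum, hε]
  · exact lt_dropTime_iff.1 h k (Finset.mem_Icc.2 ⟨hk, hkN⟩) le_rfl

theorem measurableSet_lt_dropTime {_ : MeasurableSpace Ω} (hθ : ∀ m ≤ k, Measurable (θ m)) :
    MeasurableSet {ω | (k : ℕ∞) < dropTime θ N ε ω} := by
  simp only [lt_dropTime_iff, Set.ofPred_forall]
  exact Finset.measurableSet_biInter _ fun m _ => .iInter fun hm =>
    measurableSet_le measurable_const (measurable_const.mul
      (Finset.measurable_fun_sum _ fun i hi => hθ i ((Finset.mem_Icc.1 hi).2.trans hm)))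

theorem lt_stopTime_iff : (k : ℕ∞) < stopTime H σ ξ N ω ↔
    ((k : ℕ∞) < dropTime (theta1 H σ ξ) N (eps H N) ω ∧
      (k : ℕ∞) < dropTime (theta2 H σ ξ) N (eps H N) ω) ∧
    ((k + 1 : ℕ) : ℕ∞) < dropTime (theta3 H σ ξ) N (eps H N) ω ∧
      ((k + 1 : ℕ) : ℕ∞) < dropTime (theta4 H σ ξ) N (eps H N) ω := by
  simp only [stopTime, lt_min_iff, lt_tsub_iff_right, Nat.cast_add, Nat.cast_one]

theorem xProc_zero : xProc H σ ξ 0 ω = 0 := by simp [xProc, yProc, gCoef]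

theorem measurable_info_gCoef_mul {n : ℕ} (hkn : k ≤ n) :
    Measurable[info ξ n] fun ω => gCoef H σ k * ξ k ω := by
  rcases k with _ | k
  · simp only [gCoef_zero, zero_mul]
    exact measurable_const
  · exact measurable_const.mul (measurable_info k.succ_pos hkn)

theorem measurable_info_theta1 {n : ℕ} (hkn : k ≤ n) : Measurable[info ξ n] (theta1 H σ ξ k) := by
  have hprod : theta1 H σ ξ k
      = fun ω => gCoef H σ (k - 1) * ξ (k - 1) ω * (gCoef H σ k * ξ k ω) := by
    funext ω
    rw [theta1]
    ring
  rw [hprod]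
  exact (measurable_info_gCoef_mul ((Nat.sub_le k 1).trans hkn)).mul
    (measurable_info_gCoef_mul hkn)

theorem measurable_info_theta2 {n : ℕ} (hkn : k ≤ n) : Measurable[info ξ n] (theta2 H σ ξ k) :=
  (measurable_info_gCoef_mul hkn).mul (measurable_info_yProc (by lia))

theorem measurable_info_theta3 {n : ℕ} (hkn : k ≤ n + 1) :
    Measurable[info ξ n] (theta3 H σ ξ k) :=
  (measurable_info_gCoef_mul (by lia)).mul (measurable_info_yProc hkn)

theorem measurable_info_theta4 {n : ℕ} (hkn : k ≤ n + 1) :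
    Measurable[info ξ n] (theta4 H σ ξ k) :=
  (measurable_info_yProc (by lia)).mul (measurable_info_yProc hkn)

theorem measurableSet_info_lt_stopTime :
    MeasurableSet[info ξ k] {ω | (k : ℕ∞) < stopTime H σ ξ N ω} := by
  simp only [lt_stopTime_iff]
  exact ((measurableSet_lt_dropTime fun _ => measurable_info_theta1).inter
    (measurableSet_lt_dropTime fun _ => measurable_info_theta2)).inter
    ((measurableSet_lt_dropTime fun _ => measurable_info_theta3).inter
    (measurableSet_lt_dropTime fun _ => measurable_info_theta4))

theorem measurable_info_xProc (k : ℕ) : Measurable[info ξ k] (xProc H σ ξ k) :=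
  (measurable_info_yProc k.le_succ).add (measurable_info_gCoef_mul le_rfl)

theorem measurable_info_stockPrice (N n : ℕ) : Measurable[info ξ n] (stockPrice H σ s₀ ξ N n) := by
  induction n with
  | zero => exact measurable_const
  | succ n ih =>
    exact (measurable_const.add ((measurable_info_xProc (n + 1)).div_const _)).mul
      (ih.mono (info_mono n.le_succ) le_rfl)

theorem measurable_info_stoppedStock (N k : ℕ) :
    Measurable[info ξ k] (stoppedStock H σ s₀ ξ N k) := by
  have hφ : Measurable[info ξ k] (phiStock H σ s₀ ξ N k) := by
    unfold phiStock
    split_ifs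
    · exact measurable_const
    · exact measurable_const.mul
        ((measurable_info_xProc k).div (measurable_info_stockPrice N k))
  exact hφ.ite measurableSet_info_lt_stopTime measurable_const

theorem isSelfFinancing_psi (C : ℝ) (N : ℕ) :
    IsSelfFinancing ξ (stockPrice H σ s₀ ξ N) 0 N (psi H σ s₀ C ξ N) :=
  isSelfFinancing_ofStock (measurable_info_stockPrice N) fun n =>
    measurable_const.mul (measurable_info_stoppedStock N n)

end Stopping

/-! ### The value of `ψ^N` -/

section Value

variable {Ω : Type*} {ξ : ℕ → Ω → ℝ} {H σ s₀ C C₁ C₂ : ℝ} {N : ℕ} {ω : Ω}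

theorem sum_xProc_mul_eq (m : ℕ) (ω : Ω) :
    ∑ k ∈ Finset.range m, xProc H σ ξ k ω * xProc H σ ξ (k + 1) ω
      = partialSum (theta1 H σ ξ) m ω + partialSum (theta2 H σ ξ) m ω
        + partialSum (theta3 H σ ξ) m ω + partialSum (theta4 H σ ξ) m ω := by
  induction m with
  | zero => simp [partialSum]
  | succ m ih =>
    simp only [partialSum, Finset.sum_Icc_succ_top (Nat.le_add_left 1 m)] at ih ⊢
    rw [Finset.sum_range_succ, ih]
    simp only [theta1, theta2, theta3, theta4, xProc, Nat.add_sub_cancel]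
    ring

theorem stoppedStock_mul_sub (hN : 1 ≤ N) (k : ℕ) (ω : Ω) :
    stoppedStock H σ s₀ ξ N k ω
        * (stockPrice H σ s₀ ξ N (k + 1) ω - stockPrice H σ s₀ ξ N k ω)
      = if (k : ℕ∞) < stopTime H σ ξ N ω ∧ stockPrice H σ s₀ ξ N k ω ≠ 0 then
          1 / (N : ℝ) * (xProc H σ ξ k ω * xProc H σ ξ (k + 1) ω) else 0 := by
  have hN' : (0 : ℝ) < N := by exact_mod_cast hN
  have hNH : (N : ℝ) ^ H ≠ 0 := by positivity
  rw [stoppedStock, phiStock, stockPrice, ite_and]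
  rcases eq_or_ne k 0 with rfl | hk
  · simp [xProc_zero]
  · split_ifs with hT hS
    · rw [Real.rpow_sub_one hN'.ne']
      field_simp
      ring
    · rw [not_ne_iff.1 hS, mul_zero, sub_zero, mul_zero]
    · exact zero_mul _

theorem liquidationValue_psi (hN : 1 ≤ N) (C : ℝ) (n : ℕ) (ω : Ω) :
    liquidationValue (stockPrice H σ s₀ ξ N) 0 (psi H σ s₀ C ξ N) n ω
      = 1 / √(cHat H C N) * ∑ k ∈ Finset.range n,
        if (k : ℕ∞) < stopTime H σ ξ N ω ∧ stockPrice H σ s₀ ξ N k ω ≠ 0 then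
          1 / (N : ℝ) * (xProc H σ ξ k ω * xProc H σ ξ (k + 1) ω) else 0 := by
  rw [psi, liquidationValue_ofStock, Finset.mul_sum]
  exact Finset.sum_congr rfl fun k _ => by rw [mul_assoc, stoppedStock_mul_sub hN]

theorem exists_sum_range_ite_eq {M : Type*} [AddCommMonoid M] {q : ℕ → Prop} [DecidablePred q]
    (hq : ∀ k, q (k + 1) → q k) (f : ℕ → M) (n : ℕ) : ∃ m ≤ n, (∀ k < m, q k) ∧
      ∑ k ∈ Finset.range n, (if q k then f k else 0) = ∑ k ∈ Finset.range m, f k := by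
  induction n with
  | zero => exact ⟨0, le_rfl, fun _ h => absurd h (Nat.not_lt_zero _), rfl⟩
  | succ n ih =>
    by_cases hn : q n
    · have hall : ∀ k < n + 1, q k := fun k hk =>
        Nat.decreasingInduction (motive := fun k _ => q k) (fun k _ => hq k) hn
          (Nat.lt_succ_iff.1 hk)
      exact ⟨n + 1, le_rfl, hall, Finset.sum_congr rfl fun k hk =>
        if_pos (hall k (Finset.mem_range.1 hk))⟩
    · obtain ⟨m, hmn, hm, hsum⟩ := ih
      exact ⟨m, hmn.trans n.le_succ, hm, by rw [Finset.sum_range_succ, if_neg hn, add_zero, hsum]⟩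

theorem eps_nonneg (H : ℝ) (N : ℕ) : 0 ≤ eps H N :=
  div_nonneg (Real.log_natCast_nonneg N) (by positivity)

theorem cHat_pos (H : ℝ) (hC : 0 < C) (hN : 1 ≤ N) : 0 < cHat H C N :=
  add_pos_of_nonneg_of_pos (mul_nonneg zero_le_four (eps_nonneg H N))
    (div_pos hC (Real.rpow_pos_of_pos (Nat.cast_pos.2 hN) _))

theorem neg_div_rpow_le_one_div_mul {x : ℝ} (hN : 1 ≤ N)
    (hx : |x| ≤ C * (N : ℝ) ^ (H - 1 / 2)) : -(C / (N : ℝ) ^ (3 / 2 - H)) ≤ 1 / (N : ℝ) * x := by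
  have hN' : (0 : ℝ) < N := by exact_mod_cast hN
  have hpow : (N : ℝ) ^ (3 / 2 - H) * (N : ℝ) ^ (H - 1 / 2) = N := by
    rw [← Real.rpow_add hN', show 3 / 2 - H + (H - 1 / 2) = 1 by ring, Real.rpow_one]
  have hC : C * (N : ℝ) ^ (H - 1 / 2) = C / (N : ℝ) ^ (3 / 2 - H) * N := by
    rw [div_mul_eq_mul_div, eq_div_iff (Real.rpow_pos_of_pos hN' _).ne', mul_assoc,
      mul_comm _ ((N : ℝ) ^ (3 / 2 - H)), hpow]
  rw [one_div_mul_eq_div, le_div_iff₀ hN', neg_mul, ← hC]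
  exact (abs_le.1 hx).1

theorem neg_cHat_le_sum_xProc_mul {m : ℕ} (hmN : m + 1 ≤ N)
    (hm : (m : ℕ∞) < stopTime H σ ξ N ω)
    (h₁ : |theta1 H σ ξ (m + 1) ω| ≤ C₁ * (N : ℝ) ^ (H - 1 / 2))
    (h₂ : |theta2 H σ ξ (m + 1) ω| ≤ C₂ * (N : ℝ) ^ (H - 1 / 2)) :
    -cHat H (C₁ + C₂) N ≤ 1 / (N : ℝ) *
      ∑ k ∈ Finset.range (m + 1), xProc H σ ξ k ω * xProc H σ ξ (k + 1) ω := by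
  obtain ⟨⟨hT₁, hT₂⟩, hT₃, hT₄⟩ := lt_stopTime_iff.1 hm
  have hε := eps_nonneg H N
  have hsucc : ∀ θ : ℕ → Ω → ℝ, partialSum θ (m + 1) ω = partialSum θ m ω + θ (m + 1) ω :=
    fun θ => Finset.sum_Icc_succ_top m.succ_pos _
  rw [sum_xProc_mul_eq, hsucc (theta1 H σ ξ), hsucc (theta2 H σ ξ), cHat, add_div]
  simp only [mul_add]
  linarith [neg_le_of_lt_dropTime hε (Nat.le_of_succ_le hmN) hT₁,
    neg_le_of_lt_dropTime hε (Nat.le_of_succ_le hmN) hT₂, neg_le_of_lt_dropTime hε hmN hT₃,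
    neg_le_of_lt_dropTime hε hmN hT₄, neg_div_rpow_le_one_div_mul (by lia) h₁,
    neg_div_rpow_le_one_div_mul (by lia) h₂]

theorem neg_sqrt_cHat_le_liquidationValue_psi (hN : 1 ≤ N) (hC : 0 < C₁ + C₂)
    (h₁ : ∀ n ∈ Finset.Icc 1 N, |theta1 H σ ξ n ω| ≤ C₁ * (N : ℝ) ^ (H - 1 / 2))
    (h₂ : ∀ n ∈ Finset.Icc 1 N, |theta2 H σ ξ n ω| ≤ C₂ * (N : ℝ) ^ (H - 1 / 2))
    {n : ℕ} (hn : n ≤ N) : -√(cHat H (C₁ + C₂) N)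
      ≤ liquidationValue (stockPrice H σ s₀ ξ N) 0 (psi H σ s₀ (C₁ + C₂) ξ N) n ω := by
  have hc := cHat_pos H hC hN
  obtain ⟨m, hmn, hm, hsum⟩ := exists_sum_range_ite_eq
    (q := fun k : ℕ => (k : ℕ∞) < stopTime H σ ξ N ω ∧ stockPrice H σ s₀ ξ N k ω ≠ 0)
    (fun k hk => ⟨(Nat.cast_lt.2 k.lt_succ_self).trans hk.1, right_ne_zero_of_mul hk.2⟩)
    (fun k => 1 / (N : ℝ) * (xProc H σ ξ k ω * xProc H σ ξ (k + 1) ω)) n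
  have hgain : -cHat H (C₁ + C₂) N ≤ 1 / (N : ℝ) *
      ∑ k ∈ Finset.range m, xProc H σ ξ k ω * xProc H σ ξ (k + 1) ω := by
    rcases m with _ | m
    · simpa using hc.le
    · have hmem : m + 1 ∈ Finset.Icc 1 N := Finset.mem_Icc.2 ⟨m.succ_pos, hmn.trans hn⟩
      exact neg_cHat_le_sum_xProc_mul (hmn.trans hn) (hm m m.lt_succ_self).1 (h₁ _ hmem)
        (h₂ _ hmem)
  rw [liquidationValue_psi hN, hsum, ← Finset.mul_sum]
  calc -√(cHat H (C₁ + C₂) N) = 1 / √(cHat H (C₁ + C₂) N) * -cHat H (C₁ + C₂) N := by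
        rw [mul_neg, one_div_mul_eq_div, Real.div_sqrt]
    _ ≤ _ := by gcongr

theorem ae_neg_sqrt_cHat_le_liquidationValue_psi [MeasurableSpace Ω] {P : Measure Ω}
    (h₁ : IsThetaBound P H (theta1 H σ ξ) C₁) (h₂ : IsThetaBound P H (theta2 H σ ξ) C₂)
    (hN : 1 ≤ N) {n : ℕ} (hn : n ≤ N) : ∀ᵐ ω ∂P, -√(cHat H (C₁ + C₂) N)
      ≤ liquidationValue (stockPrice H σ s₀ ξ N) 0 (psi H σ s₀ (C₁ + C₂) ξ N) n ω := by
  filter_upwards [(ae_ball_iff (Finset.countable_toSet _)).2 (h₁.2 N hN),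
    (ae_ball_iff (Finset.countable_toSet _)).2 (h₂.2 N hN)] with ω hω₁ hω₂
  exact neg_sqrt_cHat_le_liquidationValue_psi hN (add_pos h₁.1 h₂.1) hω₁ hω₂ hn

theorem liquidationValue_psi_of_stopTime_eq_top (hN : 1 ≤ N) (hT : stopTime H σ ξ N ω = ⊤)
    (hS : ∀ k ≤ N, stockPrice H σ s₀ ξ N k ω ≠ 0) (C : ℝ) :
    liquidationValue (stockPrice H σ s₀ ξ N) 0 (psi H σ s₀ C ξ N) N ω
      = 1 / √(cHat H C N) * (1 / (N : ℝ) *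
        ∑ k ∈ Finset.range N, xProc H σ ξ k ω * xProc H σ ξ (k + 1) ω) := by
  rw [liquidationValue_psi hN, Finset.mul_sum (Finset.range N) _ (1 / (N : ℝ))]
  congr 1
  exact Finset.sum_congr rfl fun k hk =>
    if_pos ⟨hT ▸ ENat.natCast_lt_top k, hS k (Finset.mem_range.1 hk).le⟩

end Value

/-! ### Convergence in probability -/

section NullEvents

variable {Ω ι : Type*} [MeasurableSpace Ω] {P : Measure Ω} {l : Filter ι}

theorem tendsto_measure_zero_of_ae_eventually_notMem [IsFiniteMeasure P] [l.IsCountablyGenerated]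
    {A : ι → Set Ω} (hA : ∀ i, MeasurableSet (A i)) (h : ∀ᵐ ω ∂P, ∀ᶠ i in l, ω ∉ A i) :
    Tendsto (fun i => P (A i)) l (𝓝 0) := by
  rw [← measure_empty (μ := P)]
  refine tendsto_measure_of_ae_tendsto_indicator_of_isFiniteMeasure l MeasurableSet.empty hA ?_
  filter_upwards [h] with ω hω
  exact hω.mono fun i hi => iff_of_false hi (Set.notMem_empty ω)

theorem tendsto_measure_union_zero {A B : ι → Set Ω} (hA : Tendsto (fun i => P (A i)) l (𝓝 0))
    (hB : Tendsto (fun i => P (B i)) l (𝓝 0)) : Tendsto (fun i => P (A i ∪ B i)) l (𝓝 0) :=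
  tendsto_of_tendsto_of_tendsto_of_le_of_le tendsto_const_nhds
    (by simpa only [add_zero] using hA.add hB) (fun _ => zero_le) fun _ => measure_union_le _ _

theorem tendsto_measure_one_of_ae_notMem_imp_mem [IsProbabilityMeasure P] {A B : ι → Set Ω}
    (hB : Tendsto (fun i => P (B i)) l (𝓝 0))
    (h : ∀ᶠ i in l, ∀ᵐ ω ∂P, ω ∉ B i → ω ∈ A i) : Tendsto (fun i => P (A i)) l (𝓝 1) := by
  have hlow : Tendsto (fun i => 1 - P (B i)) l (𝓝 1) := by
    simpa only [tsub_zero] using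
      ENNReal.Tendsto.sub tendsto_const_nhds hB (Or.inl ENNReal.one_ne_top)
  refine tendsto_of_tendsto_of_tendsto_of_le_of_le' hlow tendsto_const_nhds ?_
    (Eventually.of_forall fun _ => prob_le_one)
  filter_upwards [h] with i hi
  have hcover : (Set.univ : Set Ω) ≤ᵐ[P] (A i ∪ B i : Set Ω) := by
    filter_upwards [hi] with ω hω _
    exact or_iff_not_imp_right.2 hω
  rw [tsub_le_iff_right, ← measure_univ (μ := P)]
  exact (measure_mono_ae hcover).trans (measure_union_le _ _)

end NullEvents

section Limits

variable {H : ℝ} {N : ℕ}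

theorem tendsto_log_natCast_atTop : Tendsto (fun N : ℕ => Real.log N) atTop atTop :=
  Real.tendsto_log_atTop.comp tendsto_natCast_atTop_atTop

theorem tendsto_eps (hH1 : H < 1) : Tendsto (eps H) atTop (𝓝 0) := by
  have hδ : 0 < min (1 / 2) (2 - 2 * H) := lt_min (by norm_num) (by linarith)
  exact (isLittleO_log_rpow_atTop hδ).tendsto_div_nhds_zero.comp tendsto_natCast_atTop_atTop

theorem tendsto_cHat (hH1 : H < 1) (C : ℝ) : Tendsto (cHat H C) atTop (𝓝 0) := by
  have hpow : Tendsto (fun N : ℕ => (N : ℝ) ^ (3 / 2 - H)) atTop atTop :=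
    (tendsto_rpow_atTop (by linarith)).comp tendsto_natCast_atTop_atTop
  have hadd := ((tendsto_eps hH1).const_mul 4).add (hpow.const_div_atTop C)
  rwa [mul_zero, add_zero] at hadd

theorem tendsto_sqrt_cHat (hH1 : H < 1) (C : ℝ) :
    Tendsto (fun N => √(cHat H C N)) atTop (𝓝 0) := by
  simpa only [Real.sqrt_zero] using (tendsto_cHat hH1 C).sqrt

theorem log_mul_sqrt_le_eps_mul (H : ℝ) (hN : 1 ≤ N) : Real.log N * √N ≤ eps H N * N := by
  have hN' : (1 : ℝ) ≤ N := by exact_mod_cast hN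
  have hpow : (N : ℝ) ^ min (1 / 2) (2 - 2 * H) ≤ √N :=
    (Real.rpow_le_rpow_of_exponent_le hN' (min_le_left _ _)).trans_eq (Real.sqrt_eq_rpow _).symm
  rw [eps, div_mul_eq_mul_div, le_div_iff₀ (Real.rpow_pos_of_pos (Nat.cast_pos.2 hN) _), mul_assoc]
  refine mul_le_mul_of_nonneg_left ?_ (Real.log_natCast_nonneg N)
  calc √N * (N : ℝ) ^ min (1 / 2) (2 - 2 * H) ≤ √N * √N := by gcongr
    _ = N := Real.mul_self_sqrt N.cast_nonneg

theorem tendsto_eps_mul_atTop (H : ℝ) : Tendsto (fun N : ℕ => eps H N * N) atTop atTop := by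
  refine tendsto_atTop_mono' atTop ?_ tendsto_log_natCast_atTop
  filter_upwards [eventually_ge_atTop 1] with N hN
  exact (le_mul_of_one_le_right (Real.log_natCast_nonneg N)
    (Real.one_le_sqrt.2 (Nat.one_le_cast.2 hN))).trans (log_mul_sqrt_le_eps_mul H hN)

end Limits

/-! ### The strong asymptotic arbitrage -/

section Arbitrage

variable {Ω : Type*} {ξ θ : ℕ → Ω → ℝ} {H σ s₀ c C : ℝ} {N : ℕ} {ω : Ω}

theorem stopTime_eq_top_iff : stopTime H σ ξ N ω = ⊤ ↔
    (dropTime (theta1 H σ ξ) N (eps H N) ω = ⊤ ∧ dropTime (theta2 H σ ξ) N (eps H N) ω = ⊤) ∧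
      dropTime (theta3 H σ ξ) N (eps H N) ω = ⊤ ∧
      dropTime (theta4 H σ ξ) N (eps H N) ω = ⊤ := by
  simp only [stopTime, min_eq_top, ENat.sub_eq_top_iff, ne_eq, ENat.one_ne_top, not_false_eq_true,
    and_true]

theorem div_sqrt_cHat_le_liquidationValue_psi (hN : 1 ≤ N) (hT : stopTime H σ ξ N ω = ⊤)
    (hS : ∀ k ≤ N, stockPrice H σ s₀ ξ N k ω ≠ 0) (hε : 6 * eps H N ≤ c)
    (hgain : c * N ≤ partialSum (theta4 H σ ξ) N ω) (C : ℝ) :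
    c / 2 / √(cHat H C N)
      ≤ liquidationValue (stockPrice H σ s₀ ξ N) 0 (psi H σ s₀ C ξ N) N ω := by
  obtain ⟨⟨hT₁, hT₂⟩, hT₃, -⟩ := stopTime_eq_top_iff.1 hT
  have hlow : ∀ θ : ℕ → Ω → ℝ, dropTime θ N (eps H N) ω = ⊤ →
      -eps H N ≤ 1 / (N : ℝ) * partialSum θ N ω := fun θ hθ =>
    neg_le_of_lt_dropTime (eps_nonneg H N) le_rfl (dropTime_eq_top_iff.1 hθ)
  have hgain' : c ≤ 1 / (N : ℝ) * partialSum (theta4 H σ ξ) N ω := by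
    rwa [one_div_mul_eq_div, le_div_iff₀ (Nat.cast_pos.2 hN)]
  rw [liquidationValue_psi_of_stopTime_eq_top hN hT hS, sum_xProc_mul_eq, ← one_div_mul_eq_div]
  refine mul_le_mul_of_nonneg_left ?_ (by positivity)
  simp only [mul_add]
  linarith [hlow _ hT₁, hlow _ hT₂, hlow _ hT₃]

theorem eventually_dropTime_eq_top (hc : 0 < c)
    (h : ∀ᶠ n : ℕ in atTop, c * n ≤ partialSum θ n ω) :
    ∀ᶠ N in atTop, dropTime θ N (eps H N) ω = ⊤ := by
  have hatTop : Tendsto (fun n => partialSum θ n ω) atTop atTop :=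
    tendsto_atTop_mono' atTop h (tendsto_natCast_atTop_atTop.const_mul_atTop hc)
  obtain ⟨b, hb⟩ := bddBelow_range_of_tendsto_atTop_atTop hatTop
  filter_upwards [(tendsto_eps_mul_atTop H).eventually_ge_atTop (-b), eventually_ge_atTop 1]
    with N hbN hN
  rw [dropTime_eq_top_iff_forall hN]
  exact fun m _ => (neg_le.1 hbN).trans (hb ⟨m, rfl⟩)

theorem stockPrice_pos (hs₀ : 0 < s₀) (hX : ∀ k, 1 ≤ k → k ≤ N → |xProc H σ ξ k ω| < (N : ℝ) ^ H)
    {n : ℕ} (hn : n ≤ N) : 0 < stockPrice H σ s₀ ξ N n ω := by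
  induction n with
  | zero => exact hs₀
  | succ n ih =>
    have hlt := (abs_lt.1 (hX (n + 1) n.succ_pos hn)).1
    have hNH : 0 < (N : ℝ) ^ H := Real.rpow_pos_of_pos (Nat.cast_pos.2 (n.succ_pos.trans_le hn)) H
    refine mul_pos ?_ (ih (n.le_succ.trans hn))
    linarith [(lt_div_iff₀ hNH).2 ((neg_one_mul _).trans_lt hlt)]

variable [MeasurableSpace Ω] {P : Measure Ω}

theorem tendsto_measure_dropTime_ne_top {D : ℝ}
    (h : ∀ (N : ℕ) (c : ℝ), 0 < c → P {ω | ∃ n ∈ Finset.Icc 1 N, partialSum θ n ω < -c}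
        ≤ ENNReal.ofReal (D * N / c ^ 2)) :
    Tendsto (fun N => P {ω | dropTime θ N (eps H N) ω ≠ ⊤}) atTop (𝓝 0) := by
  have hlim : Tendsto (fun N : ℕ => ENNReal.ofReal (|D| / Real.log N ^ 2)) atTop (𝓝 0) := by
    simpa only [ENNReal.ofReal_zero, Function.comp_apply] using ENNReal.tendsto_ofReal
      (((tendsto_pow_atTop two_ne_zero).comp tendsto_log_natCast_atTop).const_div_atTop |D|)
  refine tendsto_of_tendsto_of_tendsto_of_le_of_le' tendsto_const_nhds hlim
    (Eventually.of_forall fun _ => zero_le) ?_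
  filter_upwards [tendsto_log_natCast_atTop.eventually_gt_atTop 0, eventually_ge_atTop 1]
    with N hlog hN
  have hN' : (0 : ℝ) < N := by exact_mod_cast hN
  have hscale : 0 < Real.log N * √N := mul_pos hlog (Real.sqrt_pos.2 hN')
  have hle := log_mul_sqrt_le_eps_mul H hN
  simp only [ne_eq, dropTime_eq_top_iff_forall hN, not_forall, not_le, exists_prop]
  refine (h N _ (hscale.trans_le hle)).trans (ENNReal.ofReal_le_ofReal ?_)
  calc D * N / (eps H N * N) ^ 2 ≤ |D| * N / (Real.log N * √N) ^ 2 := by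
        gcongr
        exact le_abs_self D
    _ = |D| / Real.log N ^ 2 := by
        rw [mul_pow, Real.sq_sqrt hN'.le, mul_div_mul_right _ _ hN'.ne']

theorem tendsto_measure_dropTime_ne_top_of_ae_le [IsFiniteMeasure P] (hc : 0 < c)
    (hθ : ∀ n, Measurable (θ n))
    (h : ∀ᵐ ω ∂P, ∀ᶠ n : ℕ in atTop, c * n ≤ partialSum θ n ω) :
    Tendsto (fun N => P {ω | dropTime θ N (eps H N) ω ≠ ⊤}) atTop (𝓝 0) := by
  refine tendsto_measure_zero_of_ae_eventually_notMem (fun N => ?_) ?_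
  · simp only [ne_eq, dropTime_eq_top_iff]
    exact (measurableSet_lt_dropTime fun m _ => hθ m).compl
  · filter_upwards [h] with ω hω
    exact (eventually_dropTime_eq_top hc hω).mono fun N hN => not_not.2 hN

theorem tendsto_measure_partialSum_lt [IsFiniteMeasure P] (hθ : ∀ n, Measurable (θ n))
    (h : ∀ᵐ ω ∂P, ∀ᶠ n : ℕ in atTop, c * n ≤ partialSum θ n ω) :
    Tendsto (fun N : ℕ => P {ω | partialSum θ N ω < c * N}) atTop (𝓝 0) := by
  refine tendsto_measure_zero_of_ae_eventually_notMem (fun N =>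
    measurableSet_lt (Finset.measurable_fun_sum _ fun k _ => hθ k) measurable_const) ?_
  filter_upwards [h] with ω hω
  exact hω.mono fun N hN => not_lt.2 hN

variable [IsProbabilityMeasure P]

theorem IsFairSignSequence.eventually_stockPrice_pos (hξ : IsFairSignSequence P ξ)
    (hH : 1 / 2 < H) (hH1 : H < 1) (hσ : 0 ≤ σ) (hs₀ : 0 < s₀) :
    ∀ᶠ N : ℕ in atTop, ∀ᵐ ω ∂P, ∀ n ≤ N, 0 < stockPrice H σ s₀ ξ N n ω := by
  obtain ⟨C, hC, hX⟩ := hξ.exists_abs_xProc_le hH hH1 hσ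
  filter_upwards [((tendsto_rpow_atTop one_half_pos).comp
    tendsto_natCast_atTop_atTop).eventually_gt_atTop C, eventually_ge_atTop 1] with N hNC hN
  have hN' : (0 : ℝ) < N := by exact_mod_cast hN
  filter_upwards [hX] with ω hω n hn
  refine stockPrice_pos hs₀ (fun k hk hkN => (hω k hk).trans_lt ?_) hn
  calc C * (k : ℝ) ^ (H - 1 / 2) ≤ C * (N : ℝ) ^ (H - 1 / 2) := by
        gcongr
    _ < (N : ℝ) ^ (1 / 2 : ℝ) * (N : ℝ) ^ (H - 1 / 2) := by
        gcongr
        exact hNC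
    _ = (N : ℝ) ^ H := by rw [← Real.rpow_add hN', add_sub_cancel]

theorem IsFairSignSequence.tendsto_measure_stopTime_ne_top (hξ : IsFairSignSequence P ξ)
    (hH : 1 / 2 < H) (hH1 : H < 1) (hσ : 0 < σ) :
    Tendsto (fun N => P {ω | stopTime H σ ξ N ω ≠ ⊤}) atTop (𝓝 0) := by
  obtain ⟨D₁, hD₁⟩ := hξ.exists_measure_theta1_le hH hH1 hσ.le
  obtain ⟨D₂, hD₂⟩ := hξ.exists_measure_theta2_le hH hH1 hσ.le
  obtain ⟨D₃, hD₃⟩ := hξ.exists_measure_theta3_le hH hH1 hσ.le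
  obtain ⟨c, hc, h₄⟩ := hξ.exists_ae_le_partialSum_theta4 hH hH1 hσ
  simp only [ne_eq, stopTime_eq_top_iff, not_and_or, Set.ofPred_or]
  exact tendsto_measure_union_zero
    (tendsto_measure_union_zero (tendsto_measure_dropTime_ne_top hD₁)
      (tendsto_measure_dropTime_ne_top hD₂))
    (tendsto_measure_union_zero (tendsto_measure_dropTime_ne_top hD₃)
      (tendsto_measure_dropTime_ne_top_of_ae_le hc (fun n =>
        (measurable_info_theta4 n.le_succ).mono (hξ.info_le n) le_rfl) h₄))

theorem IsFairSignSequence.exists_tendsto_measure_liquidationValue_psi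
    (hξ : IsFairSignSequence P ξ) (hH : 1 / 2 < H) (hH1 : H < 1) (hσ : 0 < σ) (hs₀ : 0 < s₀) :
    ∃ c : ℝ, 0 < c ∧ ∀ C : ℝ, Tendsto (fun N : ℕ => P {ω | c / √(cHat H C N)
      ≤ liquidationValue (stockPrice H σ s₀ ξ N) 0 (psi H σ s₀ C ξ N) N ω}) atTop (𝓝 1) := by
  obtain ⟨c, hc, h₄⟩ := hξ.exists_ae_le_partialSum_theta4 hH hH1 hσ
  refine ⟨c / 2, half_pos hc, fun C => ?_⟩
  refine tendsto_measure_one_of_ae_notMem_imp_mem (tendsto_measure_union_zero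
    (hξ.tendsto_measure_stopTime_ne_top hH hH1 hσ) (tendsto_measure_partialSum_lt (fun n =>
      (measurable_info_theta4 n.le_succ).mono (hξ.info_le n) le_rfl) h₄)) ?_
  filter_upwards [hξ.eventually_stockPrice_pos hH hH1 hσ.le hs₀, eventually_ge_atTop 1,
    (tendsto_eps hH1).eventually_le_const (div_pos hc (by norm_num : (0 : ℝ) < 6))] with N hS hN hε
  filter_upwards [hS] with ω hω hgood
  obtain ⟨hT, hgain⟩ := not_or.1 hgood
  exact div_sqrt_cHat_le_liquidationValue_psi hN (not_not.1 hT) (fun k hk => (hω k hk).ne')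
    (by linarith) (not_lt.1 hgain) C

theorem tendsto_div_sqrt_cHat_atTop (hH1 : H < 1) (hC : 0 < C) (hc : 0 < c) :
    Tendsto (fun N => c / √(cHat H C N)) atTop atTop := by
  have hzero : Tendsto (fun N => √(cHat H C N)) atTop (𝓝[>] 0) :=
    tendsto_nhdsWithin_iff.2 ⟨tendsto_sqrt_cHat hH1 C,
      (eventually_ge_atTop 1).mono fun N hN => Real.sqrt_pos.2 (cHat_pos H hC hN)⟩
  simpa only [div_eq_mul_inv, Function.comp_apply] using
    (tendsto_inv_nhdsGT_zero.comp hzero).const_mul_atTop hc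

end Arbitrage

end FractionalBinary

theorem mainTheorem1 {Ω : Type*} [MeasurableSpace Ω] (P : Measure Ω) [IsProbabilityMeasure P]
    (ξ : ℕ → Ω → ℝ) (hξ : FractionalBinary.IsFairSignSequence P ξ)
    (H σ s₀ : ℝ) (hH : 1 / 2 < H) (hH1 : H < 1) (hσ : 0 < σ) (hs₀ : 0 < s₀) :
    (∃ C₁ C₂ : ℝ,
      FractionalBinary.IsThetaBound P H (FractionalBinary.theta1 H σ ξ) C₁ ∧
      FractionalBinary.IsThetaBound P H (FractionalBinary.theta2 H σ ξ) C₂) ∧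
    ∀ C₁ C₂ : ℝ,
      FractionalBinary.IsThetaBound P H (FractionalBinary.theta1 H σ ξ) C₁ →
      FractionalBinary.IsThetaBound P H (FractionalBinary.theta2 H σ ξ) C₂ →
      FractionalBinary.ProvidesStrongAsymptoticArbitrage P ξ
        (fun N => FractionalBinary.stockPrice H σ s₀ ξ N) (fun _ => 0)
        (fun N => FractionalBinary.psi H σ s₀ (C₁ + C₂) ξ N) := by
  obtain ⟨D₁, hD₁⟩ := hξ.exists_isThetaBound_theta1 hH hH1 hσ.le
  obtain ⟨D₂, hD₂⟩ := hξ.exists_isThetaBound_theta2 hH hH1 hσ.le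
  obtain ⟨c, hc, hgain⟩ := hξ.exists_tendsto_measure_liquidationValue_psi hH hH1 hσ hs₀
  refine ⟨⟨D₁, D₂, hD₁, hD₂⟩, fun C₁ C₂ h₁ h₂ =>
    ⟨fun N _ => ⟨FractionalBinary.isSelfFinancing_psi _ N, rfl, rfl⟩, ?_⟩⟩
  have hC : 0 < C₁ + C₂ := add_pos h₁.1 h₂.1
  have hpos : ∀ N : ℕ, 1 ≤ N → 0 < √(FractionalBinary.cHat H (C₁ + C₂) N) := fun _ hN =>
    Real.sqrt_pos.2 (FractionalBinary.cHat_pos H hC hN)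
  exact ⟨fun N => √(FractionalBinary.cHat H (C₁ + C₂) N),
    fun N => c / √(FractionalBinary.cHat H (C₁ + C₂) N),
    fun N hN => ⟨hpos N hN, div_pos hc (hpos N hN)⟩,
    FractionalBinary.tendsto_sqrt_cHat hH1 (C₁ + C₂),
    FractionalBinary.tendsto_div_sqrt_cHat_atTop hH1 hC hc,
    fun _ hN _ hn => FractionalBinary.ae_neg_sqrt_cHat_le_liquidationValue_psi h₁ h₂ hN hn,
    hgain (C₁ + C₂)⟩
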